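/- Let $q$ be a prime power and $\mathcal K=\mathbb F_q((X^{-1}))$, with the absolute value normalised by $|X|=q$, so that $|f|=q^{\deg f}$ for $0\ne f\in\mathbb F_q[X]$. Let $\mathbb Z_{\mathcal O}=\{x\in\mathcal K:|x|\le 1\}$, let $n\ge 1$, and equip $\mathcal K^n$ with the norm $\|x\|=\max_i|x_i|$ and the corresponding metric. Let $\psi:\mathbb R^+\to\mathbb R^+$ be a non-increasing function such that $\psi(q^k)\in q^{\mathbb Z}=\{|x|: x\in\mathcal K\setminus\{0\}\}$ for all sufficiently large integers $k$, and such that $$\psi(|g|)=o\big(|g|^{-\frac{n+1}{n}}\big)\qquad (g\in\mathbb F_q[X],\ |g|\to\infty).$$ Let $$\lambda_\psi=\liminf_{g\in\mathbb F_q[X],\ |g|\to\infty}\frac{-\log\psi(|g|)}{\log|g|}\in(0,+\infty]$$ be the lower order of $\psi$ at infinity. Let $\operatorname{Exact}(1,n,\psi)$, the set of exactly $\psi$-approximable vectors, be the set of all $x\in\mathbb Z_{\mathcal O}^n$ such that - $\|x-\tfrac{f}{g}\|=\psi(|g|)$ for infinitely many pairs $(f,g)\in\mathbb F_q[X]^n\times(\mathbb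 F_q[X]\setminus\{0\})$, and - there is $g_0\in\mathbb F_q[X]$ such that $\|x-\tfrac fg\|\ge\psi(|g|)$ for all $f\in\mathbb F_q[X]^n$ and all $g\in\mathbb F_q[X]\setminus\{0\}$ with $|g|\ge|g_0|$. Then $$\dim_H\operatorname{Exact}(1,n,\psi)\ \ge\ \frac{n+1}{\lambda_\psi},$$ where the right-hand side is $0$ if $\lambda_\psi=+\infty$. -/

import Mathlib

open Polynomial Filter Asymptotics

noncomputable section

/-- The field `𝔽_q((X⁻¹))` of formal Laurent series in `X⁻¹` with coefficients in `F = 𝔽_q`: the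
coefficient of index `i : ℤ` of the underlying Hahn series is the coefficient of `(X⁻¹)^i`. -/
def SeriesAtInfty (F : Type*) [Field F] : Type _ := HahnSeries ℤ F

namespace SeriesAtInfty

variable {F : Type*} [Field F]

instance : Field (SeriesAtInfty F) := inferInstanceAs (Field (HahnSeries ℤ F))

/-- The order in `X⁻¹`, that is, minus the degree in `X` (and `0` for the zero series). -/
def ord (x : SeriesAtInfty F) : ℤ := HahnSeries.order (Γ := ℤ) (R := F) x

/-- The absolute value normalised by `|X| = q`: `|x| = q ^ (degree of x in X)` for `x ≠ 0`. -/
def absVal (x : SeriesAtInfty F) : ℝ :=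
  open Classical in if x = 0 then 0 else (Nat.card F : ℝ) ^ (-(ord x))

theorem one_lt_card [Finite F] : (1 : ℝ) < (Nat.card F : ℝ) := by
  exact_mod_cast Finite.one_lt_card

theorem absVal_zero : absVal (0 : SeriesAtInfty F) = 0 := by simp [absVal]

theorem absVal_of_ne {x : SeriesAtInfty F} (hx : x ≠ 0) :
    absVal x = (Nat.card F : ℝ) ^ (-(ord x)) := by simp [absVal, hx]

theorem absVal_pos [Finite F] {x : SeriesAtInfty F} (hx : x ≠ 0) : 0 < absVal x := by
  rw [absVal_of_ne hx]
  exact zpow_pos (lt_trans one_pos one_lt_card) _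

theorem absVal_nonneg [Finite F] (x : SeriesAtInfty F) : 0 ≤ absVal x := by
  by_cases hx : x = 0
  · simp [hx, absVal_zero]
  · exact (absVal_pos hx).le

theorem absVal_neg (x : SeriesAtInfty F) : absVal (-x) = absVal x := by
  by_cases hx : x = 0
  · simp [hx]
  · rw [absVal_of_ne hx, absVal_of_ne (neg_ne_zero.mpr hx)]
    congr 2
    exact HahnSeries.order_neg (f := (x : HahnSeries ℤ F))

theorem absVal_mul [Finite F] (x y : SeriesAtInfty F) :
    absVal (x * y) = absVal x * absVal y := by
  by_cases hx : x = 0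
  · simp [hx, absVal_zero]
  by_cases hy : y = 0
  · simp [hy, absVal_zero]
  rw [absVal_of_ne hx, absVal_of_ne hy, absVal_of_ne (mul_ne_zero hx hy),
    ← zpow_add₀ (lt_trans one_pos one_lt_card).ne']
  congr 1
  have h : ord (x * y) = ord x + ord y :=
    HahnSeries.order_mul (x := (x : HahnSeries ℤ F)) (y := (y : HahnSeries ℤ F)) hx hy
  rw [h]
  ring

theorem absVal_add_le_max [Finite F] (x y : SeriesAtInfty F) :
    absVal (x + y) ≤ max (absVal x) (absVal y) := by
  by_cases hx : x = 0
  · simp [hx]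
  by_cases hy : y = 0
  · simp [hy]
  by_cases hxy : x + y = 0
  · rw [hxy, absVal_zero]
    exact le_max_of_le_left (absVal_nonneg x)
  have h : min (ord x) (ord y) ≤ ord (x + y) :=
    HahnSeries.min_order_le_order_add (x := (x : HahnSeries ℤ F)) (y := (y : HahnSeries ℤ F)) hxy
  rw [absVal_of_ne hx, absVal_of_ne hy, absVal_of_ne hxy]
  rcases min_le_iff.mp h with h | h
  · exact le_max_of_le_left (zpow_le_zpow_right₀ one_lt_card.le (neg_le_neg h))
  · exact le_max_of_le_right (zpow_le_zpow_right₀ one_lt_card.le (neg_le_neg h))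

instance [Finite F] : NormedField (SeriesAtInfty F) where
  norm := absVal
  dist x y := absVal (x - y)
  dist_self x := by simp [absVal_zero]
  dist_comm x y := by rw [← absVal_neg (x - y), neg_sub]
  dist_triangle x y z := by
    have h := absVal_add_le_max (x - y) (y - z)
    rw [sub_add_sub_cancel] at h
    exact h.trans (max_le_add_of_nonneg (absVal_nonneg _) (absVal_nonneg _))
  eq_of_dist_eq_zero {x y} h := by
    by_contra hne
    exact (absVal_pos (sub_ne_zero.mpr hne)).ne' h
  dist_eq x y := by rw [← absVal_neg (x - y), neg_sub, sub_eq_neg_add]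
  norm_mul := absVal_mul

/-- The inclusion `𝔽_q[X] → 𝔽_q((X⁻¹))`; the indeterminate `X` goes to `(X⁻¹)^(-1)`. -/
def ofPoly : F[X] →+* SeriesAtInfty F :=
  Polynomial.eval₂RingHom (HahnSeries.C : F →+* HahnSeries ℤ F)
    (HahnSeries.single (-1 : ℤ) (1 : F) : HahnSeries ℤ F)

end SeriesAtInfty

open SeriesAtInfty

/-- The rational vector `f / g = (f₁ / g, …, fₙ / g)`. -/
def ratVec {F : Type*} [Field F] {n : ℕ} (f : Fin n → F[X]) (g : F[X]) :
    Fin n → SeriesAtInfty F :=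
  fun i => ofPoly (f i) / ofPoly g

/-- The set of exactly `ψ`-approximable vectors `x` with `|xᵢ| ≤ 1` for all `i`. The norm on
`𝔽_q((X⁻¹))ⁿ` is the maximum of the absolute values of the coordinates. -/
def exactApprox (F : Type*) [Field F] [Finite F] (n : ℕ) (ψ : ℝ → ℝ) :
    Set (Fin n → SeriesAtInfty F) :=
  {x | (∀ i, ‖x i‖ ≤ 1) ∧
    {p : (Fin n → F[X]) × F[X] |
      p.2 ≠ 0 ∧ ‖x - ratVec p.1 p.2‖ = ψ ‖ofPoly p.2‖}.Infinite ∧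
    ∃ g₀ : F[X], ∀ (f : Fin n → F[X]) (g : F[X]), g ≠ 0 → ‖ofPoly g₀‖ ≤ ‖ofPoly g‖ →
      ψ ‖ofPoly g‖ ≤ ‖x - ratVec f g‖}

/-- The lower order at infinity of `ψ`, the lower limit of `-log ψ(|g|) / log |g|` over polynomials
`g` with `|g| → ∞`; the values of `|g|` for `g ≠ 0` are the powers `q ^ k`. It may be `⊤`. -/
def lowerOrder (q : ℕ) (ψ : ℝ → ℝ) : EReal :=
  liminf (fun k : ℕ => ((-Real.log (ψ ((q : ℝ) ^ k)) / Real.log ((q : ℝ) ^ k) : ℝ) : EReal)) atTop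

end

/-! Write ψ(q^k) = q^(-s k) for large k. The little-o hypothesis says that n * s k - (n + 1) * k
tends to infinity, so ψ lies below the Dirichlet bound by more than any constant factor, and λ_ψ is
the lower limit of s k / k. Inside the exact set a Cantor set of digit expansions is built.

Prefixes are normally kept `Balanced`: denominators then approximate no better than Dirichlet's
exponent up to a bounded factor, hence worse than ψ. At selected places e a monic g of degree n * e
is singled out and digits are prescribed until g • x has exact order s (n * e) - n * e, so that x
lies at distance exactly ψ(|g|) from some f / g. From there `BalancedMod` is maintained: the only
additional killers are multiples of g, and these do not beat ψ because s is monotone. Once r reaches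
that order the prefix is balanced again.

The engine is `card_regular_extensions`: among the extensions of a prefix, a proportion of at least
q^(-(n + 1)) stays regular, however many digits are added. It is a first-moment argument. The mean
number of killers of each degree is known exactly, multiplication by X embeds killers of r' + 1
digits into killers of r' digits, and each bad extension contributes a whole coset outside the
image. With steps of length at least T, the branching is at least n - 2 / T per digit.

The dimension is decided at the insertions. About n * (n + 1) * e free labels are available when the
scale drops to q^(-s (n * e)), and the quotient is close to (n + 1) / λ_ψ if n * e nearly realises
the lower limit and e is far beyond the previous insertion. `Budget` keeps this account. Reading the
labels back as real digits is a Hölder map onto [0, 1], which gives the bound in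
`le_dimH_range_of_separated`. -/

namespace DigitSeq

/-! ### Digit sequences as a module over the polynomial ring -/

variable {F : Type*} [Field F]

/-- The action of a polynomial on digit sequences in which `X` acts as the left shift. -/
noncomputable def act (g : F[X]) : (ℕ → F) →ₗ[F] (ℕ → F) :=
  aeval (LinearMap.funLeft F F Nat.succ) g

theorem act_add (g h : F[X]) (y : ℕ → F) : act (g + h) y = act g y + act h y := by
  simp [act]

theorem act_sub (g h : F[X]) (y : ℕ → F) : act (g - h) y = act g y - act h y := by
  simp [act]

theorem act_mul (g h : F[X]) (y : ℕ → F) : act (g * h) y = act g (act h y) := by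
  simp [act]

theorem act_smul (c : F) (g : F[X]) (y : ℕ → F) : act (c • g) y = c • act g y := by
  simp [act]

theorem act_zero_left (y : ℕ → F) : act (0 : F[X]) y = 0 := by
  simp [act]

theorem act_C (c : F) (y : ℕ → F) : act (C c) y = c • y := by
  simp [act, Module.algebraMap_end_apply]

theorem act_X (y : ℕ → F) (j : ℕ) : act X y j = y (j + 1) := by
  simp [act, LinearMap.funLeft]

theorem act_X_pow (m : ℕ) (y : ℕ → F) (j : ℕ) : act (X ^ m) y j = y (j + m) := by
  induction m generalizing j with
  | zero => simp [act]
  | succ m ih => rw [pow_succ', act_mul, act_X, ih]; congr 1; ring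

theorem act_apply (g : F[X]) {m : ℕ} (hm : g.natDegree < m) (y : ℕ → F) (j : ℕ) :
    act g y j = ∑ l ∈ Finset.range m, g.coeff l * y (j + l) := by
  conv_lhs => rw [g.as_sum_range' m hm]
  simp only [act, map_sum, LinearMap.sum_apply, Finset.sum_apply]
  refine Finset.sum_congr rfl fun l _ => ?_
  rw [← C_mul_X_pow_eq_monomial]
  have := congrFun (act_mul (C (g.coeff l)) (X ^ l) y) j
  rw [act_C, Pi.smul_apply, act_X_pow, smul_eq_mul] at this
  exact this

theorem act_congr {g : F[X]} {y y' : ℕ → F} {j : ℕ}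
    (h : ∀ t ≤ j + g.natDegree, y t = y' t) : act g y j = act g y' j := by
  rw [act_apply g (Nat.lt_succ_self _), act_apply g (Nat.lt_succ_self _)]
  refine Finset.sum_congr rfl fun l hl => ?_
  rw [h _ (by have := Finset.mem_range.1 hl; omega)]

theorem act_eq_zero {g : F[X]} {y : ℕ → F} {j : ℕ}
    (h : ∀ t ≤ j + g.natDegree, y t = 0) : act g y j = 0 := by
  rw [act_congr (y' := 0) (by simpa using h)]; simp

/-- The first digit at which `act a y` does not vanish. -/
theorem act_leading {a : F[X]} {y : ℕ → F} {H : ℕ} (hy : ∀ t < H, y t = 0)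
    (ha : a.natDegree ≤ H) : act a y (H - a.natDegree) = a.leadingCoeff * y H := by
  rw [act_apply a (Nat.lt_succ_self _), Finset.sum_range_succ, Finset.sum_eq_zero, zero_add,
    Nat.sub_add_cancel ha, leadingCoeff]
  intro l hl
  rw [hy _ (by have := Finset.mem_range.1 hl; omega), mul_zero]

theorem act_monic {g : F[X]} (hg : g.Monic) (y : ℕ → F) (j : ℕ) :
    act g y j = (∑ l ∈ Finset.range g.natDegree, g.coeff l * y (j + l)) + y (j + g.natDegree) := by
  rw [act_apply g (Nat.lt_succ_self _), Finset.sum_range_succ, hg.coeff_natDegree, one_mul]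

/-- Two sequences with the same initial digits and the same image under a monic polynomial agree
for longer. -/
theorem eq_of_act_eq {g : F[X]} (hg : g.Monic) {y y' : ℕ → F} {E : ℕ}
    (h0 : ∀ t < g.natDegree, y t = y' t) (h : ∀ j < E, act g y j = act g y' j) :
    ∀ t < g.natDegree + E, y t = y' t := by
  intro t
  induction t using Nat.strong_induction_on with
  | _ t ih =>
    intro ht
    by_cases htm : t < g.natDegree
    · exact h0 t htm
    obtain ⟨j, rfl⟩ := Nat.exists_eq_add_of_le' (not_lt.1 htm)
    have := h j (by omega)
    rw [act_monic hg, act_monic hg, Finset.sum_congr rfl (fun l hl => by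
      rw [ih (j + l) (by have := Finset.mem_range.1 hl; omega)
        (by have := Finset.mem_range.1 hl; omega)])] at this
    exact add_left_cancel this

/-- An inhomogeneous linear recurrence with prescribed initial digits has a solution. -/
theorem exists_act_eq {g : F[X]} (hg : g.Monic) (v y₀ : ℕ → F) :
    ∃ y : ℕ → F, act g y = v ∧ ∀ t < g.natDegree, y t = y₀ t := by
  let step : (t : ℕ) → ((s : ℕ) → s < t → F) → F := fun t f =>
    if h : t < g.natDegree then y₀ t else
      v (t - g.natDegree) - ∑ l : Fin g.natDegree, g.coeff l *
        f (t - g.natDegree + l) (by have := l.2; omega)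
  let y : ℕ → F := fun t => Nat.strongRec step t
  have hy : ∀ t, y t = step t fun s _ => y s := fun t => by
    simp only [y]; rw [Nat.strongRec_eq]
  refine ⟨y, ?_, fun t ht => by rw [hy]; simp [step, ht]⟩
  funext j
  rw [act_monic hg, hy (j + g.natDegree)]
  simp only [step, Nat.add_sub_cancel, dif_neg (show ¬ (j + g.natDegree < g.natDegree) by omega)]
  rw [Fin.sum_univ_eq_sum_range (fun l => g.coeff l * y (j + l))]
  ring

/-! ### Polynomials killing initial digits -/

/-- The digits `0, …, E - 1` of `g • xᵢ` vanish for all `i`. -/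
def Kills {n : ℕ} (x : Fin n → ℕ → F) (E : ℕ) (g : F[X]) : Prop :=
  ∀ i, ∀ j < E, act g (x i) j = 0

theorem Kills.mono {n : ℕ} {x : Fin n → ℕ → F} {E E' : ℕ} {g : F[X]} (h : Kills x E g)
    (hE : E' ≤ E) : Kills x E' g := fun i j hj => h i j (hj.trans_le hE)

theorem Kills.add {n : ℕ} {x : Fin n → ℕ → F} {E : ℕ} {g g' : F[X]} (h : Kills x E g)
    (h' : Kills x E g') : Kills x E (g + g') := fun i j hj => by
  rw [act_add, Pi.add_apply, h i j hj, h' i j hj, add_zero]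

theorem Kills.sub {n : ℕ} {x : Fin n → ℕ → F} {E : ℕ} {g g' : F[X]} (h : Kills x E g)
    (h' : Kills x E g') : Kills x E (g - g') := fun i j hj => by
  rw [act_sub, Pi.sub_apply, h i j hj, h' i j hj, sub_zero]

theorem Kills.smul {n : ℕ} {x : Fin n → ℕ → F} {E : ℕ} {g : F[X]} (h : Kills x E g) (c : F) :
    Kills x E (c • g) := fun i j hj => by
  rw [act_smul, Pi.smul_apply, h i j hj, smul_zero]

theorem Kills.X_mul {n : ℕ} {x : Fin n → ℕ → F} {E : ℕ} {g : F[X]} (h : Kills x (E + 1) g) :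
    Kills x E (X * g) := fun i j hj => by
  rw [act_mul, act_X, h i _ (by omega)]

theorem Kills.congr {n : ℕ} {x x' : Fin n → ℕ → F} {E D : ℕ} {g : F[X]} (h : Kills x E g)
    (hx : ∀ i, ∀ t < D, x i t = x' i t) (hD : g.natDegree + E ≤ D) : Kills x' E g :=
  fun i j hj => by
    rw [← act_congr (y := x i) fun t ht => hx i t (by omega)]
    exact h i j hj

/-- Every array of digits `0, …, r - 1` is attained by a polynomial of degree less than `κ`. -/
def Surj {n : ℕ} (x : Fin n → ℕ → F) (κ r : ℕ) : Prop :=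
  ∀ c : Fin n → ℕ → F, ∃ p ∈ degreeLT F κ, ∀ i, ∀ j < r, act p (x i) j = c i j

theorem card_fiber_mul_card {V W : Type*} [AddCommGroup V] [Fintype V] [AddCommGroup W] [Fintype W]
    [DecidableEq W] (L : V →+ W) (hL : Function.Surjective L) (w : W) :
    (Finset.univ.filter fun v => L v = w).card * Fintype.card W = Fintype.card V := by
  have h : ∀ w', (Finset.univ.filter fun v => L v = w').card =
      (Finset.univ.filter fun v => L v = w).card := by
    intro w'
    obtain ⟨v₀, hv₀⟩ := hL (w - w')
    refine Finset.card_bij (fun v _ => v + v₀) ?_ ?_ ?_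
    · intro v hv
      simp only [Finset.mem_filter, Finset.mem_univ, true_and] at hv ⊢
      rw [map_add, hv, hv₀]; abel
    · intro a _ b _ hab
      exact add_right_cancel hab
    · intro b hb
      simp only [Finset.mem_filter, Finset.mem_univ, true_and] at hb
      refine ⟨b - v₀, ?_, sub_add_cancel _ _⟩
      simp only [Finset.mem_filter, Finset.mem_univ, true_and]
      rw [map_sub, hb, hv₀]; abel
  have := Finset.card_eq_sum_card_fiberwise (f := L) (s := Finset.univ) (t := Finset.univ)
    (fun _ _ => Finset.mem_coe.2 (Finset.mem_univ _))
  rw [Finset.card_univ, Finset.sum_congr rfl fun w' _ => h w', Finset.sum_const, smul_eq_mul,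
    Finset.card_univ, mul_comm] at this
  exact this.symm

theorem natDegree_X_pow_add {m : ℕ} {p : F[X]} (hp : p ∈ degreeLT F m) :
    (X ^ m + p).Monic ∧ (X ^ m + p).natDegree = m := by
  rw [mem_degreeLT] at hp
  refine ⟨monic_X_pow_add hp, ?_⟩
  have : (X ^ m + p).degree = (m : WithBot ℕ) := by
    rw [degree_add_eq_left_of_degree_lt (by rwa [degree_X_pow]), degree_X_pow]
  exact natDegree_eq_of_degree_eq_some this

theorem sub_X_pow_mem_degreeLT {m : ℕ} {g : F[X]} (hg : g.Monic) (hm : g.natDegree = m) :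
    g - X ^ m ∈ degreeLT F m := by
  rw [mem_degreeLT]
  have hd : g.degree = m := by rw [degree_eq_natDegree hg.ne_zero, hm]
  have := degree_sub_lt_left (p := g) (q := X ^ m) (by rw [hd, degree_X_pow]) hg.ne_zero
    (by rw [hg.leadingCoeff, leadingCoeff_X_pow])
  rwa [hd] at this

/-! ### Exact counts of killers -/

section Count

variable [Fintype F]

noncomputable instance (m : ℕ) : Fintype (degreeLT F m) :=
  Fintype.ofEquiv _ (degreeLTEquiv F m).symm.toEquiv

theorem card_degreeLT (m : ℕ) : Fintype.card (degreeLT F m) = Fintype.card F ^ m := by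
  rw [Fintype.card_congr (degreeLTEquiv F m).toEquiv]; simp

variable (F) in
/-- The monic polynomials of degree `m`. -/
noncomputable def monicDeg (m : ℕ) : Finset F[X] :=
  open Classical in Finset.univ.image fun p : degreeLT F m => X ^ m + (p : F[X])

theorem mem_monicDeg {m : ℕ} {g : F[X]} : g ∈ monicDeg F m ↔ g.Monic ∧ g.natDegree = m := by
  classical
  simp only [monicDeg, Finset.mem_image, Finset.mem_univ, true_and]
  constructor
  · rintro ⟨p, rfl⟩
    exact natDegree_X_pow_add p.2
  · rintro ⟨hg, hm⟩
    exact ⟨⟨_, sub_X_pow_mem_degreeLT hg hm⟩, by simp⟩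

-- Surjectivity already in degrees below κ makes all digit patterns equally frequent among monic
-- polynomials of degree m, so each of the n * J conditions costs exactly a factor q.
open Classical in
theorem card_monicDeg_kills {n κ r m J : ℕ} {x : Fin n → ℕ → F} (hx : Surj x κ r) (hm : κ ≤ m)
    (hJ : J ≤ r) :
    ((monicDeg F m).filter (Kills x J)).card * Fintype.card F ^ (n * J) = Fintype.card F ^ m := by
  let L : degreeLT F m →+ (Fin n → Fin J → F) :=
    { toFun := fun p i j => act (p : F[X]) (x i) j
      map_zero' := by ext; simp [act_zero_left]
      map_add' := fun p p' => by ext; simp [act_add] }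
  have hL : Function.Surjective L := fun c => by
    obtain ⟨p, hp, hpc⟩ := hx fun i j => if h : j < J then c i ⟨j, h⟩ else 0
    refine ⟨⟨p, degreeLT_mono hm hp⟩, ?_⟩
    ext i j
    have := hpc i j (j.2.trans_le hJ)
    simpa [L] using this
  have := card_fiber_mul_card L hL (fun i j => - act (X ^ m) (x i) j)
  rw [card_degreeLT] at this
  rw [← this]
  congr 1
  · symm
    refine Finset.card_bij (fun p _ => X ^ m + (p : F[X])) ?_ ?_ ?_
    · intro p hp
      simp only [Finset.mem_filter, Finset.mem_univ, true_and, mem_monicDeg] at hp ⊢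
      refine ⟨natDegree_X_pow_add p.2, fun i j hj => ?_⟩
      have := congrFun (congrFun hp i) ⟨j, hj⟩
      simp only [L, AddMonoidHom.coe_mk, ZeroHom.coe_mk] at this
      rw [act_add, Pi.add_apply, this, add_neg_cancel]
    · intro p _ p' _ h
      exact Subtype.ext (add_left_cancel h)
    · intro g hg
      simp only [Finset.mem_filter, mem_monicDeg] at hg
      refine ⟨⟨_, sub_X_pow_mem_degreeLT hg.1.1 hg.1.2⟩, ?_, by simp⟩
      simp only [Finset.mem_filter, Finset.mem_univ, true_and]
      ext i j
      simp [L, act_sub, hg.2 i j j.2]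
  · simp [← pow_mul, mul_comm]

/-- The sequence with digits `u` at the places `D, …, D + N - 1` and `0` elsewhere. -/
def place (D : ℕ) {N : ℕ} (u : Fin N → F) : ℕ → F :=
  fun t => if h : D ≤ t ∧ t - D < N then u ⟨t - D, h.2⟩ else 0

omit [Fintype F] in
theorem place_add (D : ℕ) {N : ℕ} (u u' : Fin N → F) :
    place D (u + u') = place D u + place D u' := by
  ext t; simp only [place, Pi.add_apply]; split_ifs <;> simp

omit [Fintype F] in
theorem place_zero (D : ℕ) {N : ℕ} : place D (0 : Fin N → F) = 0 := by
  ext t; simp [place]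

omit [Fintype F] in
theorem place_of_lt {D t : ℕ} (h : t < D) {N : ℕ} (u : Fin N → F) : place D u t = 0 := by
  simp only [place]; rw [dif_neg (by omega)]

/-- The prefix of length `D` of `x` continued by the digits `u`. -/
def extend {n : ℕ} (x : Fin n → ℕ → F) (D : ℕ) {N : ℕ} (u : Fin n → Fin N → F) : Fin n → ℕ → F :=
  fun i => x i + place D (u i)

omit [Fintype F] in
theorem extend_of_lt {n : ℕ} (x : Fin n → ℕ → F) {D t : ℕ} (h : t < D) {N : ℕ}
    (u : Fin n → Fin N → F) (i : Fin n) : extend x D u i t = x i t := by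
  simp [extend, place_of_lt h]

-- Digits of g • xᵢ before D - m are fixed by the prefix. Since g is monic, each later digit brings
-- in one new digit of xᵢ with coefficient 1, so the remaining conditions are independent.
open Classical in
theorem card_extend_kills {n D N E m : ℕ} {x : Fin n → ℕ → F} {g : F[X]} (hg : g.Monic)
    (hm : g.natDegree = m) (hJ : D - m ≤ E) (hE : E + m ≤ D + N) (h0 : Kills x (D - m) g) :
    (Finset.univ.filter fun u : Fin n → Fin N → F => Kills (extend x D u) E g).card *
      Fintype.card F ^ (n * (E - (D - m))) = Fintype.card F ^ (n * N) := by
  let L : (Fin n → Fin N → F) →+ (Fin n → Fin (E - (D - m)) → F) :=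
    { toFun := fun u i j => act g (place D (u i)) (D - m + j)
      map_zero' := by ext; simp [place_zero]
      map_add' := fun p p' => by ext; simp [place_add] }
  have hL : Function.Surjective L := fun c => by
    choose y hy hy0 using fun i => exists_act_eq hg (place (D - m) (c i)) 0
    -- Zero initial digits and a right-hand side supported from D - m on force the solution to
    -- vanish before D, so it is carried by the new digits alone.
    have hyD : ∀ i, ∀ t < D, y i t = 0 := fun i t ht =>
      eq_of_act_eq hg (y' := 0) (E := D - m) (hy0 i)
        (fun j hj => by rw [hy, place_of_lt hj]; simp) t (by omega)
    refine ⟨fun i j => y i (D + j), ?_⟩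
    ext i j
    have hj := j.2
    simp only [L, AddMonoidHom.coe_mk, ZeroHom.coe_mk]
    rw [act_congr (y' := y i), hy]
    · simp [place]
    · intro t ht
      simp only [place]
      by_cases h : D ≤ t
      · rw [dif_pos ⟨h, by omega⟩]; congr 1; omega
      · rw [dif_neg (by omega), hyD i t (by omega)]
  have := card_fiber_mul_card L hL (fun i j => - act g (x i) (D - m + j))
  rw [show Fintype.card (Fin n → Fin N → F) = Fintype.card F ^ (n * N) by
    simp [← pow_mul, mul_comm]] at this
  rw [← this]
  congr 1
  · congr 1
    ext u
    simp only [Finset.mem_filter, Finset.mem_univ, true_and]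
    constructor
    · intro h
      ext i j
      have hj := j.2
      have := h i (D - m + j) (by omega)
      rw [extend, map_add, Pi.add_apply] at this
      exact eq_neg_of_add_eq_zero_right this
    · intro h i j hj
      by_cases hjD : j < D - m
      · rw [act_congr (y' := x i) fun t ht => extend_of_lt x (by omega) u i]
        exact h0 i j hjD
      · have := congrFun (congrFun h i) ⟨j - (D - m), by omega⟩
        simp only [L, AddMonoidHom.coe_mk, ZeroHom.coe_mk] at this
        rw [Nat.add_sub_cancel' (not_lt.1 hjD)] at this
        rw [extend, map_add, Pi.add_apply, this, add_neg_cancel]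
  · simp [← pow_mul, mul_comm]

-- Conditions settled by the prefix are counted over g, the others over the new digits u. The two
-- factors multiply to q^(n * E), so the mean number of killers is q^m / q^(n * E) wherever the
-- prefix ends.
open Classical in
theorem sum_card_kills {n κ r N E m : ℕ} {x : Fin n → ℕ → F} (hx : Surj x κ r) (hm : κ ≤ m)
    (hJ : κ + r - m ≤ E) (hE : E + m ≤ κ + r + N) :
    (∑ u : Fin n → Fin N → F, ((monicDeg F m).filter (Kills (extend x (κ + r) u) E)).card) *
      Fintype.card F ^ (n * E) = Fintype.card F ^ (m + n * N) := by
  have h1 : ∑ u : Fin n → Fin N → F, ((monicDeg F m).filter (Kills (extend x (κ + r) u) E)).card =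
      ∑ g ∈ monicDeg F m, (Finset.univ.filter
        fun u : Fin n → Fin N → F => Kills (extend x (κ + r) u) E g).card := by
    simp_rw [Finset.card_filter]
    rw [Finset.sum_comm]
  have h2 : ∀ g ∈ monicDeg F m, (Finset.univ.filter
        fun u : Fin n → Fin N → F => Kills (extend x (κ + r) u) E g).card *
        Fintype.card F ^ (n * (E - (κ + r - m))) =
      if Kills x (κ + r - m) g then Fintype.card F ^ (n * N) else 0 := by
    intro g hg
    obtain ⟨hg, hgm⟩ := mem_monicDeg.1 hg
    split_ifs with h
    · exact card_extend_kills hg hgm hJ hE h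
    · rw [Finset.card_eq_zero.2, zero_mul]
      refine Finset.filter_eq_empty_iff.2 fun u _ hu => h ?_
      rcases le_total (κ + r) m with hle | hle
      · intro i j hj
        omega
      · exact (hu.mono hJ).congr (D := κ + r) (fun i t ht => extend_of_lt x ht u i) (by omega)
  have h3 := card_monicDeg_kills hx hm (J := κ + r - m) (by omega)
  have h4 : n * E = n * (E - (κ + r - m)) + n * (κ + r - m) := by
    rw [← mul_add, Nat.sub_add_cancel hJ]
  rw [h1, h4, pow_add, ← mul_assoc, Finset.sum_mul, Finset.sum_congr rfl h2, ← Finset.sum_filter,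
    Finset.sum_const, smul_eq_mul, pow_add, ← h3]
  ring

end Count

end DigitSeq

/-! ### A positive proportion of extensions is regular -/

namespace DigitSeq

variable {F : Type*} [Field F] [Fintype F]

-- Multiplication by X injects the killers of r' + 1 digits into those of r' digits, one degree
-- higher. If some killer lies outside the expected space P, one of least degree is not such a
-- shift, even modulo P, so its whole coset is an extra contribution.
open Classical in
theorem card_killers_shift {n κ κ' r' t' : ℕ} {y : Fin n → ℕ → F} {P : Submodule F F[X]}
    [Finite P] (hP : Nat.card P = Fintype.card F ^ t')
    (hPdeg : P ≤ degreeLT F κ) (h2 : ∀ g ∈ degreeLT F κ, Kills y r' g → g ∈ P)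
    (h3 : ∀ p ∈ P, Kills y r' p) (h4 : ∀ p ∈ P, Kills y r' (X * p) → X * p ∈ P) :
    (∑ m ∈ Finset.Ico κ (κ' - 1), ((monicDeg F m).filter (Kills y (r' + 1))).card) +
      (if ∀ g ∈ degreeLT F κ', Kills y r' g → g ∈ P then 0 else Fintype.card F ^ t') ≤
    ∑ m ∈ Finset.Ico κ κ', ((monicDeg F m).filter (Kills y r')).card := by
  let S := (Finset.Ico κ κ').biUnion fun m => (monicDeg F m).filter (Kills y r')
  let S' := (Finset.Ico κ (κ' - 1)).biUnion fun m => (monicDeg F m).filter (Kills y (r' + 1))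
  have hS : ∀ g, g ∈ S ↔ g.Monic ∧ κ ≤ g.natDegree ∧ g.natDegree < κ' ∧ Kills y r' g := by
    intro g
    simp only [S, Finset.mem_biUnion, Finset.mem_Ico, Finset.mem_filter, mem_monicDeg]
    constructor
    · rintro ⟨m, ⟨h, h'⟩, ⟨hg, rfl⟩, hk⟩
      exact ⟨hg, h, h', hk⟩
    · rintro ⟨hg, h, h', hk⟩
      exact ⟨_, ⟨h, h'⟩, ⟨hg, rfl⟩, hk⟩
  have hS' : ∀ g, g ∈ S' ↔
      g.Monic ∧ κ ≤ g.natDegree ∧ g.natDegree < κ' - 1 ∧ Kills y (r' + 1) g := by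
    intro g
    simp only [S', Finset.mem_biUnion, Finset.mem_Ico, Finset.mem_filter, mem_monicDeg]
    constructor
    · rintro ⟨m, ⟨h, h'⟩, ⟨hg, rfl⟩, hk⟩
      exact ⟨hg, h, h', hk⟩
    · rintro ⟨hg, h, h', hk⟩
      exact ⟨_, ⟨h, h'⟩, ⟨hg, rfl⟩, hk⟩
  have hdis : ∀ (s : Finset ℕ) (E : ℕ), ∑ m ∈ s, ((monicDeg F m).filter (Kills y E)).card =
      (s.biUnion fun m => (monicDeg F m).filter (Kills y E)).card := by
    intro s E
    rw [Finset.card_biUnion]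
    intro a _ b _ hab
    rw [Function.onFun, Finset.disjoint_left]
    intro g hg hg'
    simp only [Finset.mem_filter, mem_monicDeg] at hg hg'
    exact hab (hg.1.2.symm.trans hg'.1.2)
  rw [hdis, hdis]
  change S'.card + _ ≤ S.card
  have hinj : Function.Injective fun g : F[X] => X * g := mul_right_injective₀ X_ne_zero
  have hsub : S'.image (fun g => X * g) ⊆ S := by
    intro g hg
    obtain ⟨g, hg', rfl⟩ := Finset.mem_image.1 hg
    obtain ⟨hm, hd, hd', hk⟩ := (hS' g).1 hg'
    have : (X * g).natDegree = g.natDegree + 1 := natDegree_X_mul hm.ne_zero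
    exact (hS _).2 ⟨monic_X.mul hm, by omega, by omega, hk.X_mul⟩
  rw [← Finset.card_image_of_injective S' hinj]
  split_ifs with hgood
  · exact Finset.card_le_card hsub
  push Not at hgood
  have hex : ∃ d, ∃ g ∈ degreeLT F κ', Kills y r' g ∧ g ∉ P ∧ g.natDegree = d :=
    let ⟨g, h, h', h''⟩ := hgood; ⟨_, g, h, h', h'', rfl⟩
  obtain ⟨g, hgd, hgk, hgP, hgn⟩ := Nat.find_spec hex
  have hmin : ∀ f, f.natDegree < g.natDegree → Kills y r' f → f ∈ P := by
    intro f hf hfk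
    by_contra hfP
    refine Nat.find_min hex (hgn ▸ hf) ⟨f, ?_, hfk, hfP, rfl⟩
    rw [mem_degreeLT] at hgd ⊢
    exact (degree_lt_degree hf).trans hgd
  have hg0 : g ≠ 0 := fun h => hgP (h ▸ P.zero_mem)
  have hgκ : κ ≤ g.natDegree := by
    by_contra h
    refine hgP (h2 g ?_ hgk)
    rw [mem_degreeLT, degree_eq_natDegree hg0]
    exact_mod_cast not_le.1 h
  have hgκ' : g.natDegree < κ' := by
    rw [mem_degreeLT, degree_eq_natDegree hg0] at hgd
    exact_mod_cast hgd
  set c := g.leadingCoeff⁻¹ with hc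
  have hc0 : c ≠ 0 := inv_ne_zero (leadingCoeff_ne_zero.2 hg0)
  set g₁ := c • g with hg₁
  have hg₁m : g₁.Monic := by
    rw [hg₁, Monic, leadingCoeff_smul_of_smul_regular _ (IsSMulRegular.of_ne_zero hc0), hc]
    simp [hg0]
  have hg₁n : g₁.natDegree = g.natDegree := natDegree_smul g hc0
  have hPdeg' : ∀ p ∈ P, p.degree < g₁.degree := by
    intro p hp
    have := hPdeg hp
    rw [mem_degreeLT] at this
    rw [degree_eq_natDegree hg₁m.ne_zero, hg₁n]
    exact this.trans_le (by exact_mod_cast hgκ)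
  -- Elements of P have degree below κ, so the coset of the normalised least exception consists of
  -- monic polynomials of the same degree.
  let T := (Set.toFinite (P : Set F[X])).toFinset.image fun p => g₁ + p
  have hTcard : T.card = Fintype.card F ^ t' := by
    rw [Finset.card_image_of_injective _ (add_right_injective g₁), ← hP,
      ← Set.ncard_eq_toFinset_card _ (Set.toFinite _)]
    rfl
  have hTsub : T ⊆ S := by
    intro f hf
    obtain ⟨p, hp, rfl⟩ := Finset.mem_image.1 hf
    have hp : p ∈ P := by simpa using hp
    have hn : (g₁ + p).natDegree = g.natDegree := by
      rw [natDegree_add_eq_left_of_degree_lt (hPdeg' p hp), hg₁n]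
    exact (hS _).2 ⟨hg₁m.add_of_left (hPdeg' p hp), hn ▸ hgκ, hn ▸ hgκ',
      (hgk.smul c).add (h3 p hp)⟩
  have hdisj : Disjoint (S'.image fun g => X * g) T := by
    rw [Finset.disjoint_left]
    intro f hf hf'
    obtain ⟨f, hfS, rfl⟩ := Finset.mem_image.1 hf
    obtain ⟨p, hp, hpf⟩ := Finset.mem_image.1 hf'
    have hp : p ∈ P := by simpa using hp
    obtain ⟨hm, -, -, hk⟩ := (hS' f).1 hfS
    have hfn : (X * f).natDegree = f.natDegree + 1 := natDegree_X_mul hm.ne_zero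
    have hn : (g₁ + p).natDegree = g.natDegree := by
      rw [natDegree_add_eq_left_of_degree_lt (hPdeg' p hp), hg₁n]
    -- If the coset met the shifts, X * f = g₁ + p, minimality would put f into P, then `h4` would
    -- put X * f, and hence g₁, into P.
    have hfP := hmin f (by rw [← hn, hpf, hfn]; omega) (hk.mono (by omega))
    have h5 := h4 f hfP hk.X_mul
    have h6 : g₁ ∈ P := by
      rw [← hpf] at h5
      exact (P.add_mem_iff_left hp).1 h5
    apply hgP
    have := P.smul_mem c⁻¹ h6
    rwa [hg₁, inv_smul_smul₀ hc0] at this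
  rw [← hTcard, ← Finset.card_union_of_disjoint hdisj]
  exact Finset.card_le_card (Finset.union_subset hsub hTsub)

-- Here Q counts all extensions and B the bad ones, p = q^n, w = q^(n * r'), u = q^t', c = q^κ, and
-- a, b are the sums of q^m over the two degree ranges of `card_killers_shift`. The main terms leave
-- B / Q at most 1 - 1 / (p * q).
omit [Fintype F] in
theorem real_bound {q p w u c a b B Q : ℝ} (hq : 2 ≤ q) (hp : 1 ≤ p) (hw : 0 < w) (hu : 0 < u)
    (hc : 0 ≤ c) (hB : 0 ≤ B) (hQ : 0 < Q) (ha : a * (q - 1) = w * u - c)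
    (hb : b * (q - 1) * q = w * u - c * q)
    (h : B * u ≤ Q / w * a - Q / (w * p) * b) : Q ≤ p * q * (Q - B) := by
  have h1 : B * u * w * p ≤ Q * (p * a - b) := by
    have := mul_le_mul_of_nonneg_right h (by positivity : 0 ≤ w * p)
    have e : (Q / w * a - Q / (w * p) * b) * (w * p) = Q * (p * a - b) := by
      field_simp
    rw [e] at this
    linarith
  have h2 : 0 ≤ p * a - b := by
    by_contra hneg
    have : Q * (p * a - b) < 0 := mul_neg_of_pos_of_neg hQ (not_le.1 hneg)
    have : 0 ≤ B * u * w * p := by positivity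
    linarith
  have h3 : q * (q - 1) * (p * a - b) ≤ w * u * (p * q - 1) := by
    have : q * (q - 1) * (p * a - b) = p * q * (w * u - c) - (w * u - c * q) := by
      rw [← ha, ← hb]; ring
    rw [this]
    nlinarith [mul_nonneg hc (by nlinarith : 0 ≤ (p - 1) * q)]
  have h4 : q * (p * a - b) ≤ w * u * (p * q - 1) := by
    refine le_trans ?_ h3
    nlinarith [mul_nonneg (by linarith : (0 : ℝ) ≤ q) h2]
  have h5 : (w * u) * (q * p * B) ≤ (w * u) * (Q * (p * q - 1)) := by
    calc (w * u) * (q * p * B) = q * (B * u * w * p) := by ring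
      _ ≤ q * (Q * (p * a - b)) := by gcongr
      _ = Q * (q * (p * a - b)) := by ring
      _ ≤ Q * (w * u * (p * q - 1)) := by gcongr
      _ = _ := by ring
  have h6 := le_of_mul_le_mul_left h5 (by positivity)
  linarith

open Classical in
/-- A positive proportion, not depending on the number of new digits, of the extensions of a
prefix is again regular. -/
theorem card_regular_extensions {n κ r κ' r' t' N : ℕ} {x : Fin n → ℕ → F}
    {P : Submodule F F[X]} [Finite P] (hx : Surj x κ r) (hκ : κ ≤ κ') (hr : r ≤ r')
    (hκ' : κ' = n * r' + t') (hN : κ + r + N = κ' + r')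
    (hP : Nat.card P = Fintype.card F ^ t') (hPdeg : P ≤ degreeLT F κ)
    (h2 : ∀ y : Fin n → ℕ → F, (∀ i, ∀ t < κ + r, y i t = x i t) →
      ∀ g ∈ degreeLT F κ, Kills y r' g → g ∈ P)
    (h3 : ∀ y : Fin n → ℕ → F, (∀ i, ∀ t < κ + r, y i t = x i t) → ∀ p ∈ P, Kills y r' p)
    (h4 : ∀ y : Fin n → ℕ → F, (∀ i, ∀ t < κ + r, y i t = x i t) →
      ∀ p ∈ P, Kills y r' (X * p) → X * p ∈ P) :
    Fintype.card F ^ (n * N) ≤ Fintype.card F ^ (n + 1) *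
      (Finset.univ.filter fun u : Fin n → Fin N → F =>
        ∀ g ∈ degreeLT F κ', Kills (extend x (κ + r) u) r' g → g ∈ P).card := by
  set q := Fintype.card F with hq
  have hq2 : 2 ≤ q := Fintype.one_lt_card
  have hagree : ∀ u : Fin n → Fin N → F, ∀ i, ∀ t < κ + r, extend x (κ + r) u i t = x i t :=
    fun u i t ht => extend_of_lt x ht u i
  set good : (Fin n → Fin N → F) → Prop := fun u =>
    ∀ g ∈ degreeLT F κ', Kills (extend x (κ + r) u) r' g → g ∈ P with hgood
  have hcard : Fintype.card (Fin n → Fin N → F) = q ^ (n * N) := by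
    simp [← pow_mul, mul_comm, hq]
  -- No new degree may come under control, for instance in the locked state with n = 1; then every
  -- extension is good by `h2`.
  rcases hκ.eq_or_lt with heq | hlt
  · have : (Finset.univ.filter good) = Finset.univ := by
      refine Finset.filter_true_of_mem fun u _ => ?_
      rw [hgood]; dsimp only
      rw [← heq]
      exact h2 _ (hagree u)
    rw [this, Finset.card_univ, hcard]
    exact Nat.le_mul_of_pos_left _ (by positivity)
  have hsum := Finset.sum_le_sum fun (u : Fin n → Fin N → F) (_ : u ∈ Finset.univ) =>
    card_killers_shift (κ' := κ') hP hPdeg (h2 _ (hagree u)) (h3 _ (hagree u)) (h4 _ (hagree u))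
  rw [Finset.sum_add_distrib, Finset.sum_comm,
    Finset.sum_comm (s := Finset.univ) (t := Finset.Ico κ κ')] at hsum
  have hq0 : (0 : ℝ) < q := by positivity
  have key : ∀ E m : ℕ, κ ≤ m → κ + r - m ≤ E → E + m ≤ κ + r + N →
      ((∑ u : Fin n → Fin N → F,
        ((monicDeg F m).filter (Kills (extend x (κ + r) u) E)).card : ℕ) : ℝ) =
      (q : ℝ) ^ (n * N) / (q : ℝ) ^ (n * E) * (q : ℝ) ^ m := by
    intro E m hm hJ hE
    have := sum_card_kills (N := N) hx hm hJ hE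
    rw [div_mul_eq_mul_div, eq_div_iff (by positivity)]
    rw [← pow_add, add_comm (n * N)]
    exact_mod_cast this
  have hbad : (∑ u : Fin n → Fin N → F, if good u then 0 else q ^ t') =
      (q ^ (n * N) - (Finset.univ.filter good).card) * q ^ t' := by
    rw [Finset.sum_ite, Finset.sum_const_zero, zero_add, Finset.sum_const, smul_eq_mul,
      Finset.filter_not, Finset.card_sdiff_of_subset (Finset.filter_subset _ _),
      Finset.card_univ, hcard]
  have hgle : (Finset.univ.filter good).card ≤ q ^ (n * N) := by
    rw [← hcard]; exact Finset.card_le_univ _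
  rw [hbad] at hsum
  have hsumR : ((∑ m ∈ Finset.Ico κ (κ' - 1), ∑ u : Fin n → Fin N → F,
      ((monicDeg F m).filter (Kills (extend x (κ + r) u) (r' + 1))).card : ℕ) : ℝ) +
      ((q : ℝ) ^ (n * N) - (Finset.univ.filter good).card) * (q : ℝ) ^ t' ≤
      ((∑ m ∈ Finset.Ico κ κ', ∑ u : Fin n → Fin N → F,
      ((monicDeg F m).filter (Kills (extend x (κ + r) u) r')).card : ℕ) : ℝ) := by
    have : (((q ^ (n * N) - (Finset.univ.filter good).card : ℕ) * q ^ t' : ℕ) : ℝ) =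
        ((q : ℝ) ^ (n * N) - (Finset.univ.filter good).card) * (q : ℝ) ^ t' := by
      rw [Nat.cast_mul, Nat.cast_sub hgle]; push_cast; ring
    rw [← this]
    exact_mod_cast hsum
  rw [Nat.cast_sum, Nat.cast_sum, Finset.sum_congr rfl fun m hm => key (r' + 1) m
      (Finset.mem_Ico.1 hm).1 (by have := Finset.mem_Ico.1 hm; omega)
      (by have := Finset.mem_Ico.1 hm; omega),
    Finset.sum_congr rfl fun m hm => key r' m
      (Finset.mem_Ico.1 hm).1 (by have := Finset.mem_Ico.1 hm; omega)
      (by have := Finset.mem_Ico.1 hm; omega), ← Finset.mul_sum, ← Finset.mul_sum] at hsumR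
  have hB : (0 : ℝ) ≤ (q : ℝ) ^ (n * N) - (Finset.univ.filter good).card := by
    rw [sub_nonneg]; exact_mod_cast hgle
  have hfin := real_bound (q := q) (p := (q : ℝ) ^ n) (w := (q : ℝ) ^ (n * r'))
    (u := (q : ℝ) ^ t') (c := (q : ℝ) ^ κ) (Q := (q : ℝ) ^ (n * N))
    (a := ∑ m ∈ Finset.Ico κ κ', (q : ℝ) ^ m) (b := ∑ m ∈ Finset.Ico κ (κ' - 1), (q : ℝ) ^ m)
    (by exact_mod_cast hq2) (one_le_pow₀ (by exact_mod_cast (by omega : 1 ≤ q)))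
    (by positivity) (by positivity) (by positivity) hB (by positivity)
    (by rw [geom_sum_Ico_mul _ hκ, ← pow_add, hκ'])
    (by
      rw [geom_sum_Ico_mul _ (by omega), sub_mul, ← pow_succ, Nat.sub_add_cancel (by omega),
        ← pow_add, hκ'])
    (by
      rw [← pow_add, ← mul_add_one]
      linarith)
  rw [sub_sub_cancel, ← pow_succ] at hfin
  exact_mod_cast hfin

end DigitSeq

/-! ### Balanced prefixes and their children -/

namespace DigitSeq

variable {F : Type*} [Field F]

/-- The lattice of `x` is balanced at `r`: no nonzero polynomial of degree less than `n * r`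
kills the first `r` digits of all `xᵢ`. -/
def Balanced {n : ℕ} (x : Fin n → ℕ → F) (r : ℕ) : Prop :=
  ∀ g ∈ degreeLT F (n * r), Kills x r g → g = 0

/-- The fractional part of `g • x` has exact order `h`, and the first `r` digits of `x` are killed,
below degree `n * r + (h - r)`, by the multiples `a * g` with `deg a < h - r` only. -/
def BalancedMod {n : ℕ} (x : Fin n → ℕ → F) (g : F[X]) (h r : ℕ) : Prop :=
  Kills x (h - 1) g ∧ (∃ i, act g (x i) (h - 1) ≠ 0) ∧
    ∀ g' ∈ degreeLT F (n * r + (h - r)), Kills x r g' → ∃ a ∈ degreeLT F (h - r), g' = a * g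

theorem natDegree_lt_of_mem_degreeLT {m : ℕ} {p : F[X]} (hp : p ∈ degreeLT F m) (h0 : p ≠ 0) :
    p.natDegree < m := by
  rw [mem_degreeLT, degree_eq_natDegree h0] at hp
  exact_mod_cast hp

theorem mem_degreeLT_of_natDegree {m : ℕ} {p : F[X]} (hp : p.natDegree < m) :
    p ∈ degreeLT F m := by
  rw [mem_degreeLT]
  exact degree_le_natDegree.trans_lt (by exact_mod_cast hp)

theorem Kills.congr_lt {n : ℕ} {x x' : Fin n → ℕ → F} {E D κ : ℕ} {g : F[X]} (h : Kills x E g)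
    (hx : ∀ i, ∀ t < D, x i t = x' i t) (hg : g ∈ degreeLT F κ) (hD : κ + E ≤ D) :
    Kills x' E g := by
  by_cases h0 : g = 0
  · intro i j _
    simp [h0, act_zero_left]
  · exact h.congr hx (by have := natDegree_lt_of_mem_degreeLT hg h0; omega)

theorem Balanced.congr {n : ℕ} {x x' : Fin n → ℕ → F} {r : ℕ} (h : Balanced x r)
    (hx : ∀ i, ∀ t < n * r + r, x i t = x' i t) : Balanced x' r := fun g hg hk =>
  h g hg (hk.congr_lt (fun i t ht => (hx i t ht).symm) hg le_rfl)

/-- The order condition reads digits up to h - 1 + deg g, and the condition on killers reads degrees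
below n * r + (h - r) with r further digits; both stay below n * r + h. -/
theorem BalancedMod.congr {n : ℕ} {x x' : Fin n → ℕ → F} {g : F[X]} {h r : ℕ} (hr : r ≤ h)
    (hh : 1 ≤ h) (hg : g.natDegree ≤ n * r) (H : BalancedMod x g h r)
    (hx : ∀ i, ∀ t < n * r + h, x i t = x' i t) : BalancedMod x' g h r := by
  obtain ⟨h1, ⟨i, hi⟩, h3⟩ := H
  refine ⟨h1.congr hx (by omega), ⟨i, ?_⟩, fun g' hg' hk => h3 g' hg' ?_⟩
  · rwa [← act_congr (y := x i) fun t ht => hx i t (by omega)]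
  · exact hk.congr_lt (fun i t ht => (hx i t ht).symm) hg' (by omega)

/-- The multiples `g * a` with `deg a < t`. -/
noncomputable def multiples (g : F[X]) (t : ℕ) : Submodule F F[X] :=
  (degreeLT F t).map (LinearMap.mulLeft F g)

theorem mem_multiples {g p : F[X]} {t : ℕ} :
    p ∈ multiples g t ↔ ∃ a ∈ degreeLT F t, p = a * g := by
  simp only [multiples, Submodule.mem_map, LinearMap.mulLeft_apply]
  exact exists_congr fun a => and_congr_right fun _ => by rw [mul_comm, eq_comm]

theorem multiples_le {g : F[X]} {t κ : ℕ} (h : g.natDegree + t ≤ κ) :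
    multiples g t ≤ degreeLT F κ := by
  intro p hp
  obtain ⟨a, ha, rfl⟩ := mem_multiples.1 hp
  by_cases h0 : a = 0
  · simp [h0]
  have := natDegree_lt_of_mem_degreeLT ha h0
  have h' := natDegree_mul_le (p := a) (q := g)
  exact mem_degreeLT_of_natDegree (by omega)

section Finite

variable [Fintype F]

instance (g : F[X]) (t : ℕ) : Finite (multiples g t) :=
  Finite.of_surjective (fun a : degreeLT F t => (⟨a * g, mem_multiples.2 ⟨a, a.2, rfl⟩⟩ :
    multiples g t)) fun p => by
      obtain ⟨a, ha, h⟩ := mem_multiples.1 p.2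
      exact ⟨⟨a, ha⟩, Subtype.ext h.symm⟩

theorem card_multiples {g : F[X]} (hg : g ≠ 0) (t : ℕ) :
    Nat.card (multiples g t) = Fintype.card F ^ t := by
  have h : Function.Injective (LinearMap.mulLeft F g) := mul_right_injective₀ hg
  rw [← card_degreeLT, ← Nat.card_eq_fintype_card]
  exact (Nat.card_congr (Submodule.equivMapOfInjective _ h (degreeLT F t)).toEquiv).symm

/-- Rank-nullity: the kernel has dimension at most t in a space of dimension n * r + t, so the rank
fills the n * r target digits. -/
theorem surj_of_kills_mem {n κ r t : ℕ} {x : Fin n → ℕ → F} {P : Submodule F F[X]} [Finite P]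
    (hP : Nat.card P = Fintype.card F ^ t) (hκ : κ = n * r + t)
    (h : ∀ g ∈ degreeLT F κ, Kills x r g → g ∈ P) : Surj x κ r := by
  let L : degreeLT F κ →ₗ[F] (Fin n → Fin r → F) :=
    { toFun := fun p i j => act (p : F[X]) (x i) j
      map_add' := fun p p' => by ext; simp [act_add]
      map_smul' := fun c p => by ext; simp [act_smul] }
  have hker : Nat.card (LinearMap.ker L) ≤ Nat.card P := by
    refine Nat.card_le_card_of_injective
      (fun p => (⟨((p : degreeLT F κ) : F[X]), h _ p.1.2 fun i j hj => ?_⟩ : P)) ?_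
    · exact congrFun (congrFun (LinearMap.mem_ker.1 p.2) i) ⟨j, hj⟩
    · intro p p' hpp
      exact Subtype.ext (Subtype.ext (Subtype.mk.inj hpp))
  have hq : 1 < Fintype.card F := Fintype.one_lt_card
  rw [hP, Module.natCard_eq_pow_finrank (K := F), Nat.card_eq_fintype_card,
    Nat.pow_le_pow_iff_right hq] at hker
  have hfin : Module.finrank F (degreeLT F κ) = κ := by
    rw [(degreeLTEquiv F κ).finrank_eq]; simp
  have h1 := LinearMap.finrank_range_add_finrank_ker L
  have h2 : LinearMap.range L = ⊤ := by
    refine Submodule.eq_top_of_finrank_eq (le_antisymm (Submodule.finrank_le _) ?_)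
    simp only [Module.finrank_pi_fintype, Module.finrank_self, Finset.sum_const, Finset.card_univ,
      Fintype.card_fin, smul_eq_mul, mul_one]
    omega
  intro c
  obtain ⟨p, hp⟩ := LinearMap.range_eq_top.1 h2 fun i j => c i j
  exact ⟨p, p.2, fun i j hj => congrFun (congrFun hp i) ⟨j, hj⟩⟩

theorem Balanced.surj {n r : ℕ} {x : Fin n → ℕ → F} (h : Balanced x r) : Surj x (n * r) r :=
  surj_of_kills_mem (P := ⊥) (t := 0) (by simp) rfl fun g hg hk => (Submodule.mem_bot F).2 (h g hg hk)

theorem BalancedMod.surj {n h r : ℕ} {x : Fin n → ℕ → F} {g : F[X]} (hg : g ≠ 0)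
    (H : BalancedMod x g h r) : Surj x (n * r + (h - r)) r :=
  surj_of_kills_mem (card_multiples hg _) rfl fun g' hg' hk => mem_multiples.2 (H.2.2 g' hg' hk)

/-- `x`, known up to the place `D`, has `q ^ M` extensions with the property `Good` which are told
apart by their digits before the place `D'`. -/
def HasChildren {n : ℕ} (x : Fin n → ℕ → F) (D D' M : ℕ) (Good : (Fin n → ℕ → F) → Prop) : Prop :=
  ∃ c : (Fin M → Fin (Fintype.card F)) → Fin n → ℕ → F,
    (∀ l, (∀ i, ∀ t < D, c l i t = x i t) ∧ Good (c l)) ∧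
    ∀ l l', l ≠ l' → ∃ i, ∃ t < D', c l i t ≠ c l' i t

omit [Field F] in
theorem HasChildren.mono {n D D' M : ℕ} {x : Fin n → ℕ → F} {Good Good' : (Fin n → ℕ → F) → Prop}
    (h : HasChildren x D D' M Good) (hG : ∀ y, Good y → Good' y) : HasChildren x D D' M Good' := by
  obtain ⟨c, h1, h2⟩ := h
  exact ⟨c, fun l => ⟨(h1 l).1, hG _ (h1 l).2⟩, h2⟩

open Classical in
theorem hasChildren_of_card {n D N : ℕ} {x : Fin n → ℕ → F} {Good : (Fin n → ℕ → F) → Prop}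
    (h : Fintype.card F ^ (n * N) ≤ Fintype.card F ^ (n + 1) *
      (Finset.univ.filter fun u : Fin n → Fin N → F => Good (extend x D u)).card) :
    HasChildren x D (D + N) (n * N - (n + 1)) Good := by
  set q := Fintype.card F with hq
  have hq0 : 0 < q := Fintype.card_pos
  set S := Finset.univ.filter fun u : Fin n → Fin N → F => Good (extend x D u) with hS
  have hle : q ^ (n * N - (n + 1)) ≤ S.card := by
    rcases le_total (n + 1) (n * N) with hc | hc
    · refine le_of_mul_le_mul_left (a := q ^ (n + 1)) ?_ (by positivity)
      rwa [← pow_add, Nat.add_sub_cancel' hc]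
    -- For short extensions the truncated exponent is 0, and the bound only asserts that some good
    -- extension exists.
    · rw [Nat.sub_eq_zero_of_le hc, pow_zero]
      by_contra h0
      rw [Nat.lt_one_iff.1 (not_le.1 h0), mul_zero] at h
      exact absurd h (not_le.2 (by positivity))
  have : Nonempty ((Fin (n * N - (n + 1)) → Fin q) ↪ S) := by
    rw [Function.Embedding.nonempty_iff_card_le]
    simpa using hle
  obtain ⟨f⟩ := this
  refine ⟨fun l => extend x D (f l : Fin n → Fin N → F), fun l => ⟨fun i t ht => extend_of_lt x ht _ i, ?_⟩, ?_⟩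
  · have := (f l).2
    exact (Finset.mem_filter.1 this).2
  · intro l l' hll
    by_contra hcon
    push Not at hcon
    refine hll (f.injective (Subtype.ext ?_))
    funext i j
    have hj := j.2
    have := hcon i (D + j) (by omega)
    simpa [extend, place] using this

theorem Balanced.hasChildren {n r r' : ℕ} {x : Fin n → ℕ → F} (h : Balanced x r) (hr : r ≤ r') :
    HasChildren x ((n + 1) * r) ((n + 1) * r') (n * ((n + 1) * (r' - r)) - (n + 1))
      fun y => Balanced y r' := by
  classical
  have e : (n + 1) * r' = n * r + r + (n + 1) * (r' - r) := by
    obtain ⟨d, rfl⟩ := Nat.exists_eq_add_of_le hr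
    rw [Nat.add_sub_cancel_left]; ring
  rw [e, show (n + 1) * r = n * r + r by ring]
  apply hasChildren_of_card
  have := card_regular_extensions (N := (n + 1) * (r' - r)) (P := ⊥) (t' := 0) (κ' := n * r')
    h.surj (Nat.mul_le_mul_left n hr) hr rfl (by rw [← e]; ring) (by simp) bot_le ?_ ?_ ?_
  · refine this.trans (Nat.mul_le_mul_left _ (Finset.card_le_card fun u hu => ?_))
    simp only [Finset.mem_filter, Finset.mem_univ, true_and, Submodule.mem_bot] at hu ⊢
    exact hu
  · intro y hy g hg hk
    exact (Submodule.mem_bot F).2 (h.congr (fun i t ht => (hy i t ht).symm) g hg (hk.mono hr))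
  · intro y _ p hp i j _
    rw [(Submodule.mem_bot F).1 hp, act_zero_left]; rfl
  · intro y _ p hp _
    rw [(Submodule.mem_bot F).1 hp, mul_zero]
    exact Submodule.zero_mem _

-- In a coordinate where g • y has order exactly h, the product a * g has a nonzero digit at h - 1 -
-- deg a; killing r digits forces this place to be at least r.
omit [Fintype F] in
theorem mem_degreeLT_of_kills_mul {n h r : ℕ} {y : Fin n → ℕ → F} {g a : F[X]}
    (h1 : Kills y (h - 1) g) (h2 : ∃ i, act g (y i) (h - 1) ≠ 0) (ha : a.natDegree < h)
    (hk : Kills y r (a * g)) : a ∈ degreeLT F (h - r) := by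
  by_cases h0 : a = 0
  · simp [h0]
  obtain ⟨i, hi⟩ := h2
  refine mem_degreeLT_of_natDegree ?_
  by_contra hcon
  have := hk i (h - 1 - a.natDegree) (by omega)
  rw [act_mul, act_leading (h1 i) (by omega)] at this
  exact mul_ne_zero (leadingCoeff_ne_zero.2 h0) hi this

/-- The unavoidable killers are the multiples a * g with deg a < h - r'. This space shrinks as r'
grows, so its role as P in `card_regular_extensions` is checked against the new place r'. -/
theorem BalancedMod.hasChildren {n h r r' : ℕ} {x : Fin n → ℕ → F} {g : F[X]} (hg : g.Monic)
    (hgd : g.natDegree ≤ n * r) (H : BalancedMod x g h r) (hr : r ≤ r') (hrh : r' ≤ h)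
    (hr1 : 1 ≤ r') (hn : 1 ≤ n) :
    HasChildren x (n * r + h) (n * r' + h) (n * (n * (r' - r)) - (n + 1))
      fun y => BalancedMod y g h r' := by
  classical
  have e : n * r' + h = n * r + (h - r) + r + n * (r' - r) := by
    obtain ⟨d, rfl⟩ := Nat.exists_eq_add_of_le hr
    rw [Nat.add_sub_cancel_left, mul_add]; omega
  have e' : n * r + h = n * r + (h - r) + r := by omega
  have hyx : ∀ y : Fin n → ℕ → F, (∀ i, ∀ t < n * r + (h - r) + r, y i t = x i t) →
      BalancedMod y g h r := fun y hy =>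
    H.congr (by omega) (by omega) hgd fun i t ht => (hy i t (by omega)).symm
  rw [e, e']
  apply hasChildren_of_card
  have := card_regular_extensions (N := n * (r' - r)) (P := multiples g (h - r')) (t' := h - r')
    (κ' := n * r' + (h - r')) (H.surj hg.ne_zero)
    (by
      obtain ⟨d, rfl⟩ := Nat.exists_eq_add_of_le hr
      have : d ≤ n * d := Nat.le_mul_of_pos_left d hn
      rw [mul_add]; omega)
    hr rfl (by omega) (card_multiples hg.ne_zero _) (multiples_le (by omega)) ?_ ?_ ?_
  · refine this.trans (Nat.mul_le_mul_left _ (Finset.card_le_card fun u hu => ?_))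
    simp only [Finset.mem_filter, Finset.mem_univ, true_and] at hu ⊢
    obtain ⟨h1, h2, -⟩ := hyx (extend x (n * r + (h - r) + r) u)
      fun i t ht => extend_of_lt x ht u i
    exact ⟨h1, h2, fun g' hg' hk => mem_multiples.1 (hu g' hg' hk)⟩
  · intro y hy g' hg' hk
    obtain ⟨h1, h2, h3⟩ := hyx y hy
    obtain ⟨a, ha, rfl⟩ := h3 g' hg' (hk.mono hr)
    refine mem_multiples.2 ⟨a, mem_degreeLT_of_kills_mul h1 h2 ?_ hk, rfl⟩
    by_cases h0 : a = 0
    · rw [h0, natDegree_zero]; omega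
    · have := natDegree_lt_of_mem_degreeLT ha h0; omega
  · intro y hy p hp i j hj
    obtain ⟨h1, -, -⟩ := hyx y hy
    obtain ⟨a, ha, rfl⟩ := mem_multiples.1 hp
    by_cases h0 : a = 0
    · simp [h0, act_zero_left]
    have := natDegree_lt_of_mem_degreeLT ha h0
    rw [act_mul]
    exact act_eq_zero fun t ht => h1 i t (by omega)
  · intro y hy p hp hk
    obtain ⟨h1, h2, -⟩ := hyx y hy
    obtain ⟨a, ha, rfl⟩ := mem_multiples.1 hp
    rw [← mul_assoc] at hk ⊢
    refine mem_multiples.2 ⟨X * a, mem_degreeLT_of_kills_mul h1 h2 ?_ hk, rfl⟩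
    by_cases h0 : a = 0
    · rw [h0, mul_zero, natDegree_zero]; omega
    · have := natDegree_lt_of_mem_degreeLT ha h0
      rw [natDegree_X_mul h0]; omega

omit [Fintype F] in
theorem BalancedMod.balanced {n h : ℕ} {x : Fin n → ℕ → F} {g : F[X]} (H : BalancedMod x g h h) :
    Balanced x h := by
  intro g' hg' hk
  obtain ⟨a, ha, rfl⟩ := H.2.2 g' (by simpa using hg') hk
  rw [Nat.sub_self, mem_degreeLT, Nat.cast_zero] at ha
  rw [degree_eq_bot.1 (Nat.WithBot.lt_zero_iff.1 ha), zero_mul]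

/-- From a balanced prefix one can pass to a prefix which is exactly approximated by a rational
vector with denominator of degree `n * e`. -/
theorem Balanced.exists_balancedMod {n e h : ℕ} {x : Fin n → ℕ → F} (hn : 1 ≤ n)
    (H : Balanced x e) (he : e < h) :
    ∃ y : Fin n → ℕ → F, (∀ i, ∀ t < (n + 1) * e, y i t = x i t) ∧
      ∃ g : F[X], g.Monic ∧ g.natDegree = n * e ∧ BalancedMod y g h e := by
  -- Balance makes the digit map surjective, so a monic g of degree n * e killing the known e digits
  -- can be solved for.
  obtain ⟨p, hp, hpc⟩ := H.surj fun i j => - act (X ^ (n * e)) (x i) j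
  obtain ⟨hg, hgd⟩ := natDegree_X_pow_add hp
  set g := X ^ (n * e) + p with hgdef
  have hk : Kills x e g := fun i j hj => by
    rw [hgdef, act_add, Pi.add_apply, hpc i j hj, add_neg_cancel]
  -- Each coordinate solves the recurrence for g with a single digit 1 at place h - 1, which gives
  -- the exact order h; up to place n * e + e it reproduces x.
  choose y hy hy0 using fun i => exists_act_eq hg (fun t => if t = h - 1 then (1 : F) else 0) (x i)
  have hyz : Kills y (h - 1) g := fun i j hj => by
    rw [hy]; exact if_neg (by omega)
  have hyx : ∀ i, ∀ t < n * e + e, y i t = x i t := fun i t ht =>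
    eq_of_act_eq hg (E := e) (hy0 i) (fun j hj => by rw [hk i j hj, hyz i j (by omega)]) t
      (by omega)
  refine ⟨y, fun i t ht => hyx i t (by linarith [add_one_mul n e]), g, hg, hgd, hyz,
    ⟨⟨0, hn⟩, by simp [hy]⟩, fun g' hg' hk' => ?_⟩
  -- Dividing a killer by g, the quotient part is killed on its own, so the remainder is a killer of
  -- degree below n * e and vanishes by balance.
  have hdm := modByMonic_add_div g' g
  have hmod : (g' %ₘ g) ∈ degreeLT F (n * e) := by
    rw [mem_degreeLT, ← hgd, ← degree_eq_natDegree hg.ne_zero]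
    exact degree_modByMonic_lt g' hg
  have hdiv : (g' /ₘ g) ∈ degreeLT F (h - e) := by
    by_cases h0 : g' /ₘ g = 0
    · simp [h0]
    by_cases h0' : g' = 0
    · simp [h0']
    have h5 := natDegree_lt_of_mem_degreeLT hg' h0'
    refine mem_degreeLT_of_natDegree ?_
    rw [natDegree_divByMonic g' hg]
    omega
  have hkd : Kills y e (g * (g' /ₘ g)) := fun i j hj => by
    rw [mul_comm, act_mul]
    by_cases h0 : g' /ₘ g = 0
    · simp [h0, act_zero_left]
    have := natDegree_lt_of_mem_degreeLT hdiv h0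
    exact act_eq_zero fun t ht => hyz i t (by omega)
  have hkm : Kills y e (g' %ₘ g) := by
    have := hk'.sub hkd
    rwa [← eq_sub_of_add_eq hdm] at this
  have h0 := H.congr (fun i t ht => (hyx i t ht).symm) _ hmod hkm
  refine ⟨g' /ₘ g, hdiv, ?_⟩
  rw [h0, zero_add] at hdm
  rw [mul_comm, hdm]

end Finite

end DigitSeq

/-! ### The tree of prefixes and the schedule of states -/

namespace DigitSeq

variable {F : Type*} [Field F] [Fintype F]

omit [Field F] in
/-- The branches of a tree of digit sequences whose nodes of level `j` have `q ^ M j` children. -/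
theorem exists_branches {n : ℕ} {D M : ℕ → ℕ} (hD : StrictMono D)
    {Good : ℕ → (Fin n → ℕ → F) → Prop} {x₀ : Fin n → ℕ → F} (h0 : Good 0 x₀)
    (hcongr : ∀ j x x', (∀ i, ∀ t < D j, x i t = x' i t) → Good j x → Good j x')
    (hstep : ∀ j x, Good j x → HasChildren x (D j) (D (j + 1)) (M j) (Good (j + 1))) :
    ∃ Φ : (ℕ → Fin (Fintype.card F)) → Fin n → ℕ → F, (∀ ω j, Good j (Φ ω)) ∧
      ∀ ω ω' j, (∀ t < ∑ k ∈ Finset.range j, M k, ω t = ω' t) →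
        (∃ t < ∑ k ∈ Finset.range (j + 1), M k, ω t ≠ ω' t) →
        ∃ i, ∃ t < D (j + 1), Φ ω i t ≠ Φ ω' i t := by
  choose c hc hsep using hstep
  let A : ℕ → ℕ := fun j => ∑ k ∈ Finset.range j, M k
  have hA : ∀ j, A (j + 1) = A j + M j := fun j => Finset.sum_range_succ _ _
  let label : (ℕ → Fin (Fintype.card F)) → (j : ℕ) → Fin (M j) → Fin (Fintype.card F) :=
    fun ω j m => ω (A j + m)
  let node : (ℕ → Fin (Fintype.card F)) → (j : ℕ) → {x // Good j x} := fun ω j =>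
    Nat.rec ⟨x₀, h0⟩ (fun j x => ⟨c j x.1 x.2 (label ω j), (hc j x.1 x.2 _).2⟩) j
  have hnode : ∀ ω j, (node ω (j + 1)).1 = c j (node ω j).1 (node ω j).2 (label ω j) :=
    fun ω j => rfl
  have hagree1 : ∀ ω j i, ∀ t < D j, (node ω (j + 1)).1 i t = (node ω j).1 i t := fun ω j i t ht => by
    rw [hnode]; exact (hc j _ _ _).1 i t ht
  have hagree : ∀ ω j k, j ≤ k → ∀ i, ∀ t < D j, (node ω k).1 i t = (node ω j).1 i t := by
    intro ω j k hjk i t ht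
    induction k, hjk using Nat.le_induction with
    | base => rfl
    | succ k hk ih => rw [hagree1 ω k i t (ht.trans_le (hD.monotone hk)), ih]
  -- Since D is strictly increasing, t < D (t + 1), so the node of level t + 1 has already settled
  -- digit t.
  let Φ : (ℕ → Fin (Fintype.card F)) → Fin n → ℕ → F := fun ω i t => (node ω (t + 1)).1 i t
  have hΦ : ∀ ω j i, ∀ t < D j, Φ ω i t = (node ω j).1 i t := by
    intro ω j i t ht
    rcases le_total j (t + 1) with h | h
    · exact hagree ω j (t + 1) h i t ht
    · exact (hagree ω (t + 1) j h i t (lt_of_lt_of_le (Nat.lt_succ_self t) (hD.id_le _))).symm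
  refine ⟨Φ, fun ω j => hcongr j _ _ (fun i t ht => (hΦ ω j i t ht).symm) (node ω j).2, ?_⟩
  intro ω ω' j hlt ⟨t, ht, hne⟩
  have hsame : ∀ k ≤ j, node ω k = node ω' k := by
    intro k
    induction k with
    | zero => intro _; rfl
    | succ k ih =>
      intro hk
      have h1 := ih (by omega)
      have h2 : label ω k = label ω' k := by
        funext m
        refine hlt _ ?_
        have : A (k + 1) ≤ A j := Finset.sum_le_sum_of_subset (Finset.range_mono hk)
        have := hA k
        have := m.2
        change _ < A j
        omega
      refine Subtype.ext ?_
      rw [hnode, hnode, h2]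
      congr 1
      rw [h1]
  have hj := hsame j le_rfl
  have hl : label ω j ≠ label ω' j := by
    intro h
    have h1 : ¬ t < A j := fun h' => hne (hlt t h')
    have h2 : t < A (j + 1) := ht
    rw [hA] at h2
    have := congrFun h ⟨t - A j, by omega⟩
    simp only [label] at this
    rw [Nat.add_sub_cancel' (by omega)] at this
    exact hne this
  obtain ⟨i, t', ht', hne'⟩ := hsep j _ (node ω j).2 _ _ hl
  refine ⟨i, t', ht', ?_⟩
  rw [hΦ ω _ i t' ht', hΦ ω' _ i t' ht', hnode, hnode, ← hj]
  exact hne'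

/-- States of the construction. In the state `free r e` the lattice is balanced at `r` and a rational
vector of denominator degree `n * e` is to be inserted at `e`; in the state `locked r e` it has been
inserted and has not yet been compensated for. -/
inductive St
  | free (r e : ℕ)
  | locked (r e : ℕ)

namespace St

/-- The number of digits known in a state. -/
def places (n : ℕ) (h : ℕ → ℕ) : St → ℕ
  | free r _ => (n + 1) * r
  | locked r e => n * r + h e

/-- The degree below which all denominators are controlled in a state. -/
def controlled (n : ℕ) (h : ℕ → ℕ) : St → ℕ
  | free r _ => n * r
  | locked r e => n * r + (h e - r)

/-- The place at which the lattice is balanced, up to the inserted rational vector. -/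
def balancedAt : St → ℕ
  | free r _ => r
  | locked r _ => r

/-- The logarithm of the number of children in the passage between two states. -/
def branching (n : ℕ) : St → St → ℕ
  | free r _, free r' _ => n * ((n + 1) * (r' - r)) - (n + 1)
  | free _ _, locked _ _ => 0
  | locked r _, σ => n * (n * (σ.balancedAt - r)) - (n + 1)

/-- The relations between the entries of a state that make the next step possible. -/
def Valid (n T K : ℕ) (h : ℕ → ℕ) : St → Prop
  | free r e => (r = e ∨ r + T ≤ e) ∧ e + T ≤ h e ∧ K ≤ n * e
  | locked r e => e ≤ r ∧ r + T ≤ h e ∧ K ≤ n * e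

/-- The passages between states: the balanced place grows by steps between `T` and `2 * T`, at `e`
a rational vector is inserted, and at `h e` it is released and a new target is chosen. -/
inductive Next (T : ℕ) (h tgt : ℕ → ℕ) : St → St → Prop
  | grow {r r' e : ℕ} : r + T ≤ r' → r' ≤ r + 2 * T → Next T h tgt (free r e) (free r' e)
  | jump {e : ℕ} : Next T h tgt (free e e) (locked e e)
  | growLocked {r r' e : ℕ} : r + T ≤ r' → r' ≤ r + 2 * T → r' ≤ h e →
      Next T h tgt (locked r e) (locked r' e)
  | release {r e : ℕ} : r + T ≤ h e → h e ≤ r + 2 * T →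
      Next T h tgt (locked r e) (free (h e) (tgt (h e)))

/-- The property of digit sequences maintained in a state. -/
def Good {n : ℕ} (h : ℕ → ℕ) : St → (Fin n → ℕ → F) → Prop
  | free r _, x => Balanced x r
  | locked r e, x => ∃ g : F[X], g.Monic ∧ g.natDegree = n * e ∧ BalancedMod x g (h e) r

/-- Advance by T until less than 2 * T remains, then cover the remainder in one step. No growth step
is shorter than T, where the branching loss would matter, or longer than 2 * T. -/
theorem exists_next {n T K : ℕ} {h tgt : ℕ → ℕ}
    (htgt : ∀ a, a + T ≤ tgt a ∧ tgt a + T ≤ h (tgt a) ∧ K ≤ n * tgt a) {σ : St}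
    (hσ : σ.Valid n T K h) : ∃ σ', Next T h tgt σ σ' ∧ σ'.Valid n T K h := by
  cases σ with
  | free r e =>
    obtain ⟨h1, h2, h3⟩ := hσ
    by_cases hre : r = e
    · subst hre
      exact ⟨locked r r, .jump, le_rfl, h2, h3⟩
    have h1 := h1.resolve_left hre
    by_cases hlt : e < r + 2 * T
    · exact ⟨free e e, .grow h1 hlt.le, Or.inl rfl, h2, h3⟩
    · exact ⟨free (r + T) e, .grow le_rfl (by omega), Or.inr (by omega), h2, h3⟩
  | locked r e =>
    obtain ⟨h1, h2, h3⟩ := hσ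
    by_cases hlt : h e < r + 2 * T
    · obtain ⟨h4, h5, h6⟩ := htgt (h e)
      exact ⟨_, .release h2 hlt.le, Or.inr h4, h5, h6⟩
    · exact ⟨locked (r + T) e, .growLocked le_rfl (by omega) (by omega), by omega, by omega, h3⟩

theorem exists_path {n T K : ℕ} {h tgt : ℕ → ℕ}
    (htgt : ∀ a, a + T ≤ tgt a ∧ tgt a + T ≤ h (tgt a) ∧ K ≤ n * tgt a) :
    ∃ σ : ℕ → St, σ 0 = free 0 (tgt 0) ∧ (∀ j, Next T h tgt (σ j) (σ (j + 1))) ∧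
      ∀ j, (σ j).Valid n T K h := by
  choose f hf hv using fun σ : {σ : St // σ.Valid n T K h} => exists_next htgt σ.2
  let σ : ℕ → {σ : St // σ.Valid n T K h} := fun j =>
    Nat.rec ⟨free 0 (tgt 0), Or.inr (htgt 0).1, (htgt 0).2⟩ (fun _ τ => ⟨f τ, hv τ⟩) j
  exact ⟨fun j => (σ j).1, rfl, fun j => hf (σ j), fun j => (σ j).2⟩

theorem Next.places_lt {n T K : ℕ} {h tgt : ℕ → ℕ} {σ σ' : St} (hT : 1 ≤ T) (hn : 1 ≤ n)
    (hσ : σ.Valid n T K h) (hs : Next T h tgt σ σ') : σ.places n h < σ'.places n h := by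
  cases hs with
  | grow h1 h2 => exact Nat.mul_lt_mul_of_pos_left (by omega) (by omega)
  | jump =>
    have := hσ.2.1
    simp only [places, add_one_mul]
    omega
  | growLocked h1 h2 h3 =>
    simp only [places]
    exact Nat.add_lt_add_right (Nat.mul_lt_mul_of_pos_left (by omega) hn) _
  | release h1 h2 =>
    simp only [places, add_one_mul]
    exact Nat.add_lt_add_right (Nat.mul_lt_mul_of_pos_left (by omega) hn) _

omit [Fintype F] in
theorem Good.congr {n T K : ℕ} {h : ℕ → ℕ} {σ : St} (hT : 1 ≤ T)
    (hσ : σ.Valid n T K h) {x x' : Fin n → ℕ → F}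
    (hx : ∀ i, ∀ t < σ.places n h, x i t = x' i t) (hg : σ.Good h x) : σ.Good h x' := by
  cases σ with
  | free r e => exact Balanced.congr hg fun i t ht => hx i t (by simpa [places, add_one_mul] using ht)
  | locked r e =>
    obtain ⟨g, hm, hd, hb⟩ := hg
    obtain ⟨h1, h2, -⟩ := hσ
    exact ⟨g, hm, hd, hb.congr (by omega) (by omega) (by rw [hd]; exact Nat.mul_le_mul_left n h1) hx⟩

theorem Next.hasChildren {n T K : ℕ} {h tgt : ℕ → ℕ} {σ σ' : St} (hT : 1 ≤ T) (hn : 1 ≤ n)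
    (hσ : σ.Valid n T K h) (hs : Next T h tgt σ σ') {x : Fin n → ℕ → F} (hg : σ.Good h x) :
    HasChildren x (σ.places n h) (σ'.places n h) (branching n σ σ') (σ'.Good h) := by
  cases hs with
  | grow h1 h2 => exact Balanced.hasChildren hg (by omega)
  | @jump e =>
    obtain ⟨y, hy, g, hm, hd, hb⟩ := Balanced.exists_balancedMod (h := h e) hn hg
      (by have := hσ.2.1; omega)
    -- An insertion has exponent 0, hence a single label, and the separation condition is vacuous.
    exact ⟨fun _ => y, fun _ => ⟨hy, g, hm, hd, hb⟩,
      fun l l' hll => absurd (Subsingleton.elim (α := Fin 0 → Fin (Fintype.card F)) l l') hll⟩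
  | growLocked h1 h2 h3 =>
    obtain ⟨g, hm, hd, hb⟩ := hg
    have := hσ.1
    exact (hb.hasChildren hm (by rw [hd]; exact Nat.mul_le_mul_left n this) (by omega) h3
      (by omega) hn).mono fun y hy => ⟨g, hm, hd, hy⟩
  | @release r e h1 h2 =>
    obtain ⟨g, hm, hd, hb⟩ := hg
    have := hσ.1
    have := (hb.hasChildren hm (by rw [hd]; exact Nat.mul_le_mul_left n this)
      (by omega : r ≤ h e) le_rfl (by omega) hn).mono fun y hy => hy.balanced
    rw [← add_one_mul] at this
    exact this

end St

end DigitSeq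

/-! ### Progress of the schedule and the count of branches -/

namespace DigitSeq

namespace St

section Schedule

variable {n T K : ℕ} {h tgt : ℕ → ℕ}

theorem eventually_locked {σ : ℕ → St} (hT : 1 ≤ T) (hs : ∀ j, Next T h tgt (σ j) (σ (j + 1)))
    (hv : ∀ j, (σ j).Valid n T K h) {j r e : ℕ} (hj : σ j = free r e) : ∃ k, σ k = locked e e := by
  induction hd : e - r using Nat.strong_induction_on generalizing j r with
  | _ d ih =>
    have h1 := hs j
    have h2 := hv (j + 1)
    rw [hj] at h1
    generalize hσ : σ (j + 1) = τ at h1 h2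
    cases h1 with
    | @grow _ r' _ h3 h4 =>
      have := h2.1
      exact ih (e - r') (by omega) hσ rfl
    | jump => exact ⟨_, hσ⟩

theorem eventually_free {σ : ℕ → St} (hT : 1 ≤ T) (hs : ∀ j, Next T h tgt (σ j) (σ (j + 1)))
    {j r e : ℕ} (hj : σ j = locked r e) : ∃ k, σ k = free (h e) (tgt (h e)) := by
  induction hd : h e - r using Nat.strong_induction_on generalizing j r with
  | _ d ih =>
    have h1 := hs j
    rw [hj] at h1
    generalize hσ : σ (j + 1) = τ at h1
    cases h1 with
    | @growLocked _ r' _ h3 h4 h5 => exact ih (h e - r') (by omega) hσ rfl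
    | release => exact ⟨_, hσ⟩

theorem exists_locked_ge {σ : ℕ → St} (hT : 1 ≤ T) (h0 : σ 0 = free 0 (tgt 0))
    (hs : ∀ j, Next T h tgt (σ j) (σ (j + 1))) (hv : ∀ j, (σ j).Valid n T K h)
    (htgt : ∀ a, a + T ≤ tgt a) (m : ℕ) : ∃ j e, σ j = locked e e ∧ m ≤ e := by
  induction m with
  | zero =>
    obtain ⟨k, hk⟩ := eventually_locked hT hs hv h0
    exact ⟨k, _, hk, Nat.zero_le _⟩
  | succ m ih =>
    obtain ⟨j, e, hj, hm⟩ := ih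
    have h1 := hv j
    rw [hj] at h1
    obtain ⟨k, hk⟩ := eventually_free hT hs hj
    obtain ⟨k', hk'⟩ := eventually_locked hT hs hv hk
    have := h1.2.1
    have := htgt (h e)
    exact ⟨k', _, hk', by omega⟩

/-- Known digits grow without bound along the path, so this makes every denominator degree
eventually controlled. -/
theorem places_le_two_mul_controlled (hn : 1 ≤ n) {σ : St} (hσ : σ.Valid n T K h) :
    σ.places n h ≤ 2 * σ.controlled n h := by
  cases σ with
  | free r e =>
    have : r ≤ n * r := Nat.le_mul_of_pos_left r hn
    simp only [places, controlled, add_one_mul]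
    omega
  | locked r e =>
    have : r ≤ n * r := Nat.le_mul_of_pos_left r hn
    have := hσ.2.1
    simp only [places, controlled]
    omega

/-- Only an insertion reveals a block of unbounded length, and it does not branch. Branches that
separate therefore do so within a bounded number of digits. -/
theorem places_next_le {σ σ' : St} (hs : Next T h tgt σ σ')
    (hM : 0 < branching n σ σ') : σ'.places n h ≤ σ.places n h + (n + 1) * (2 * T) := by
  cases hs with
  | grow h1 h2 =>
    simp only [places, ← mul_add]
    exact Nat.mul_le_mul_left _ h2
  | jump => exact absurd hM (lt_irrefl _)
  | growLocked h1 h2 h3 =>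
    have := Nat.mul_le_mul_left n h2
    simp only [places]
    rw [mul_add] at this
    have : n * (2 * T) ≤ (n + 1) * (2 * T) := Nat.mul_le_mul_right _ (by omega)
    omega
  | release h1 h2 =>
    have := Nat.mul_le_mul_left n h2
    simp only [places, add_one_mul]
    rw [mul_add] at this
    omega

/-- The loss of n + 1 labels is spread over c * d ≥ c * T digits. As n + 1 ≤ 2 * c, with c = n + 1
in free steps and c = n in locked ones, it costs at most 2 / T per digit. -/
theorem le_branching {c d : ℕ} {ν : ℝ} (hT : 1 ≤ T) (hν : ν = n - 2 / T)
    (hd : T ≤ d) (hc : n + 1 ≤ 2 * c) :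
    ν * (c * d : ℝ) ≤ ((n * (c * d) - (n + 1) : ℕ) : ℝ) := by
  have h1 : (n * (c * d) : ℝ) - (n + 1) ≤ ((n * (c * d) - (n + 1) : ℕ) : ℝ) := by
    rw [sub_le_iff_le_add]
    exact_mod_cast Nat.sub_le_iff_le_add.1 le_rfl
  refine le_trans ?_ h1
  have hT' : (0 : ℝ) < T := by exact_mod_cast hT
  have h2 : (n + 1 : ℝ) ≤ 2 / T * (c * d) := by
    rw [div_mul_eq_mul_div, le_div_iff₀ hT']
    have h3 : (n + 1 : ℝ) ≤ 2 * c := by exact_mod_cast hc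
    have h4 : (T : ℝ) ≤ d := by exact_mod_cast hd
    calc (n + 1 : ℝ) * T ≤ (2 * c) * d := by gcongr
      _ = _ := by ring
  rw [hν]
  linarith

/-- The lower bound for the logarithm `A` of the number of nodes kept up to a state. -/
def Budget (n : ℕ) (s h : ℕ → ℕ) (β ν : ℝ) : St → ℝ → Prop
  | free r e, A => β * ((n + 1) * r) ≤ A ∧ β * s (n * e) ≤ A + ν * ((n + 1) * ((e : ℝ) - r))
  | locked r e, A => β * (n * r + h e) ≤ A

theorem Budget.places_le {s : ℕ → ℕ} {β ν A : ℝ} {σ : St} (hb : Budget n s h β ν σ A) :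
    β * σ.places n h ≤ A := by
  cases σ with
  | free r e => simpa [places] using hb.1
  | locked r e => simpa [places, Budget] using hb

/-- Growth at rate ν ≥ β preserves both inequalities. The second clause for a free state is a
forecast: growth up to e pays for the jump to s (n * e) known digits. At release, `htgt` renews the
forecast for the next target. -/
theorem Budget.next {s : ℕ → ℕ} {β ν A : ℝ} (hT : 1 ≤ T) (hn : 1 ≤ n) (hν : ν = n - 2 / T)
    (hβ : 0 ≤ β) (hβν : β ≤ ν) (hh : ∀ e, h e = s (n * e) - n * e)
    (htgt : ∀ a, β * s (n * tgt a) ≤ ν * ((n + 1) * ((tgt a : ℝ) - a)))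
    {σ σ' : St} (hv : σ.Valid n T K h)
    (hs : Next T h tgt σ σ') (hb : Budget n s h β ν σ A) :
    Budget n s h β ν σ' (A + branching n σ σ') := by
  cases hs with
  | @grow r r' e h1 h2 =>
    obtain ⟨d, rfl⟩ := Nat.exists_eq_add_of_le (show r ≤ r' by omega)
    have h3 := le_branching (c := n + 1) (d := d) hT hν (by omega) (by omega)
    simp only [branching, Nat.add_sub_cancel_left, Budget] at hb ⊢
    push_cast at h3 ⊢
    have h4 : β * ((n + 1) * d : ℝ) ≤ ν * ((n + 1) * d) :=
      mul_le_mul_of_nonneg_right hβν (by positivity)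
    constructor <;> nlinarith [hb.1, hb.2]
  | @jump e =>
    obtain ⟨-, h2, -⟩ := hv
    have h3 : s (n * e) = n * e + h e := by have := hh e; omega
    simp only [branching, Budget, sub_self, mul_zero, add_zero, h3] at hb ⊢
    push_cast at hb ⊢
    simpa using hb.2
  | @growLocked r r' e h1 h2 _ =>
    obtain ⟨d, rfl⟩ := Nat.exists_eq_add_of_le (show r ≤ r' by omega)
    have h3 := le_branching (c := n) (d := d) hT hν (by omega) (by omega)
    simp only [branching, balancedAt, Nat.add_sub_cancel_left, Budget] at hb ⊢
    push_cast at h3 ⊢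
    have h4 : β * (n * d : ℝ) ≤ ν * (n * d) := mul_le_mul_of_nonneg_right hβν (by positivity)
    nlinarith [hb]
  | @release r e h1 h2 =>
    obtain ⟨d, hd⟩ := Nat.exists_eq_add_of_le (show r ≤ h e by omega)
    have h3 := le_branching (c := n) (d := d) hT hν (by omega) (by omega)
    have h5 := htgt (h e)
    have h6 : 0 ≤ A := le_trans (by positivity) (show β * (n * r + h e) ≤ A from hb)
    simp only [branching, balancedAt, Budget, show h e - r = d by omega] at hb ⊢
    have h4 : β * (n * d : ℝ) ≤ ν * (n * d) := mul_le_mul_of_nonneg_right hβν (by positivity)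
    have h7 : (h e : ℝ) = r + d := by exact_mod_cast hd
    have h8 : (0 : ℝ) ≤ ((n * (n * d) - (n + 1) : ℕ) : ℝ) := Nat.cast_nonneg _
    constructor
    · rw [h7] at hb ⊢
      nlinarith [hb]
    · linarith

end Schedule

variable {F : Type*} [Field F]

/-- Approximations with denominator degree `m` between the degrees controlled in two successive
states are at least as bad as `q ^ (-s m)`. -/
theorem Good.exists_digit {n T K : ℕ} {s h tgt : ℕ → ℕ} (hn : 1 ≤ n) (hT : 1 ≤ T)
    (hh : ∀ e, h e = s (n * e) - n * e) (hmono : ∀ k k', K ≤ k → k ≤ k' → s k ≤ s k')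
    {σ σ' : St} (hv : σ.Valid n T K h) (hs : Next T h tgt σ σ') {x : Fin n → ℕ → F}
    (hg : σ'.Good h x) {g : F[X]} (hg0 : g ≠ 0) (h1 : σ.controlled n h ≤ g.natDegree)
    (h2 : g.natDegree < σ'.controlled n h)
    (hm : (n + 1) * g.natDegree + n * (2 * T) ≤ n * s g.natDegree) :
    ∃ i j, act g (x i) j ≠ 0 ∧ j + 1 + g.natDegree ≤ s g.natDegree := by
  -- A step overshoots Dirichlet's exponent by at most 2 * T digits, which the slack in `hm`
  -- absorbs.
  have hgen : ∀ r j, n * r ≤ g.natDegree → j < r + 2 * T →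
      j + 1 + g.natDegree ≤ s g.natDegree := by
    intro r j hr hj
    refine Nat.le_of_mul_le_mul_left (le_trans ?_ hm) hn
    calc n * (j + 1 + g.natDegree) ≤ n * (r + 2 * T + g.natDegree) :=
          Nat.mul_le_mul_left _ (by omega)
      _ = n * r + n * (2 * T) + n * g.natDegree := by ring
      _ ≤ g.natDegree + n * (2 * T) + n * g.natDegree := by omega
      _ = _ := by ring
  have hfree : ∀ r r', Balanced x r' → g.natDegree < n * r' → n * r ≤ g.natDegree →
      r' ≤ r + 2 * T → ∃ i j, act g (x i) j ≠ 0 ∧ j + 1 + g.natDegree ≤ s g.natDegree := by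
    intro r r' hb hlt hr hr'
    have hk : ¬ Kills x r' g := fun hk => hg0 (hb g (mem_degreeLT_of_natDegree hlt) hk)
    simp only [Kills, not_forall] at hk
    obtain ⟨i, j, hj, hne⟩ := hk
    exact ⟨i, j, hne, hgen r j hr (by omega)⟩
  have hlocked : ∀ r r' e, (∃ f : F[X], f.Monic ∧ f.natDegree = n * e ∧ BalancedMod x f (h e) r') →
      g.natDegree < n * r' + (h e - r') → n * r ≤ g.natDegree → n * e ≤ g.natDegree → K ≤ n * e →
      r' ≤ r + 2 * T → r' ≤ h e → 1 ≤ h e →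
      ∃ i j, act g (x i) j ≠ 0 ∧ j + 1 + g.natDegree ≤ s g.natDegree := by
    intro r r' e ⟨f, hf, hfd, hb1, ⟨i, hi⟩, hb3⟩ hlt hr he hK hr' hrh hh1
    by_cases hk : Kills x r' g
    · obtain ⟨a, ha, rfl⟩ := hb3 g (mem_degreeLT_of_natDegree hlt) hk
      have ha0 : a ≠ 0 := left_ne_zero_of_mul hg0
      have had := natDegree_lt_of_mem_degreeLT ha ha0
      -- For a multiple a * f of the inserted denominator, deg a cancels: the exponent of the
      -- distance is h e + n * e = s (n * e), at most s (deg g) by monotonicity.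
      refine ⟨i, h e - 1 - a.natDegree, ?_, ?_⟩
      · rw [act_mul, act_leading (hb1 i) (by omega)]
        exact mul_ne_zero (leadingCoeff_ne_zero.2 ha0) hi
      · have h5 := hmono _ _ hK he
        have h6 := hh e
        rw [natDegree_mul ha0 hf.ne_zero] at h5 ⊢
        omega
    · simp only [Kills, not_forall] at hk
      obtain ⟨i, j, hj, hne⟩ := hk
      exact ⟨i, j, hne, hgen r j hr (by omega)⟩
  cases hs with
  | @grow r r' e h3 h4 => exact hfree r r' hg h2 h1 h4
  | @jump e =>
    obtain ⟨-, h5, h6⟩ := hv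
    exact hlocked e e e hg h2 h1 h1 h6 (by omega) (by omega) (by omega)
  | @growLocked r r' e h3 h4 h5 =>
    obtain ⟨h6, h7, h8⟩ := hv
    have h9 : n * r ≤ g.natDegree := le_trans (Nat.le_add_right _ _) h1
    exact hlocked r r' e hg h2 h9 ((Nat.mul_le_mul_left n h6).trans h9) h8 h4 h5 (by omega)
  | @release r e h3 h4 =>
    exact hfree r _ hg h2 (le_trans (Nat.le_add_right _ _) h1) h4

end St

/-! ### Choice of parameters and the exact family -/

/-- Choice of the parameters of the construction. -/
theorem exists_parameters {n K : ℕ} (hn : 1 ≤ n) {s : ℕ → ℕ}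
    (hmono : ∀ k k', K ≤ k → k ≤ k' → s k ≤ s k')
    (hgrow : ∀ C : ℕ, ∀ᶠ k in atTop, (n + 1) * k + C ≤ n * s k) {β γ : ℝ} (hβ : 0 < β)
    (hγ : γ < n + 1) (hfreq : ∃ᶠ k : ℕ in atTop, β * s k ≤ γ * k) :
    ∃ T : ℕ, 1 ≤ T ∧ β ≤ n - 2 / T ∧ ∃ tgt : ℕ → ℕ, ∀ a, a + T ≤ tgt a ∧
      tgt a + T ≤ s (n * tgt a) - n * tgt a ∧ K ≤ n * tgt a ∧
      β * s (n * tgt a) ≤ ((n : ℝ) - 2 / T) * ((n + 1) * ((tgt a : ℝ) - a)) := by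
  have hn0 : (0 : ℝ) < n := by exact_mod_cast hn
  have hβγ : β * (n + 1) ≤ γ * n := by
    obtain ⟨k, hk, hk', hk0⟩ := (hfreq.and_eventually ((hgrow 0).and (eventually_gt_atTop 0))).exists
    have h1 : ((n : ℝ) + 1) * k ≤ n * s k := by exact_mod_cast hk'
    have h2 : (0 : ℝ) < k := by exact_mod_cast hk0
    have h3 : β * (((n : ℝ) + 1) * k) ≤ β * (n * s k) := mul_le_mul_of_nonneg_left h1 hβ.le
    have h4 : n * (β * s k) ≤ n * (γ * k) := mul_le_mul_of_nonneg_left hk hn0.le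
    refine le_of_mul_le_mul_right ?_ h2
    linarith
  have hγ0 : 0 < γ := by
    by_contra hneg
    have : γ * n ≤ 0 := mul_nonpos_of_nonpos_of_nonneg (not_lt.1 hneg) hn0.le
    have : 0 < β * (n + 1) := by positivity
    linarith
  -- T is large enough that the rate ν = n - 2 / T satisfies γ * n < ν * (n + 1), which is possible
  -- because γ < n + 1.
  obtain ⟨T, hT⟩ := exists_nat_gt (max 1 (2 * (n + 1) / (n * (n + 1 - γ))))
  have hT1 : (1 : ℝ) < T := lt_of_le_of_lt (le_max_left _ _) hT
  have hT0 : (0 : ℝ) < T := by linarith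
  have hδ : 0 < n * (n + 1 - γ) := mul_pos hn0 (by linarith)
  have hν : γ * n < ((n : ℝ) - 2 / T) * (n + 1) := by
    have h1 : 2 * (n + 1) / (n * (n + 1 - γ)) < T := lt_of_le_of_lt (le_max_right _ _) hT
    rw [div_lt_iff₀ hδ] at h1
    have h2 : 2 / T * (n + 1) < n * (n + 1 - γ) := by
      rw [div_mul_eq_mul_div, div_lt_iff₀ hT0]; linarith
    linarith
  set ν := (n : ℝ) - 2 / T with hνdef
  refine ⟨T, by exact_mod_cast hT1.le, ?_, ?_⟩
  · refine le_of_mul_le_mul_right (a := (n : ℝ) + 1) ?_ (by positivity)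
    linarith
  have key : ∀ a : ℕ, ∃ e : ℕ, a + T ≤ e ∧ e + T ≤ s (n * e) - n * e ∧ K ≤ n * e ∧
      β * s (n * e) ≤ ν * ((n + 1) * ((e : ℝ) - a)) := by
    intro a
    -- Beyond E, the gain (ν * (n + 1) - γ * n) * e outweighs the cost of having started only at a
    -- and of rounding k down.
    obtain ⟨E, hE⟩ := exists_nat_gt ((γ * n + ν * (n + 1) * a) / (ν * (n + 1) - γ * n))
    obtain ⟨G, hG⟩ := eventually_atTop.1 (hgrow (n * T))
    obtain ⟨k, hk, hkb⟩ := (hfreq.and_eventually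
      (eventually_ge_atTop (n * (a + T + K + E + G + 1)))).exists
    -- The favourable degree k need not be a multiple of n. Rounding down to n * e only lowers s,
    -- and changes γ * k by at most γ * n.
    obtain ⟨e, b, hb, rfl⟩ : ∃ e b, b < n ∧ k = n * e + b :=
      ⟨k / n, k % n, Nat.mod_lt _ hn, (Nat.div_add_mod k n).symm⟩
    have he : a + T + K + E + G + 1 ≤ e := by
      by_contra hcon
      have := Nat.mul_le_mul_left n (show e + 1 ≤ a + T + K + E + G + 1 by omega)
      rw [mul_add_one] at this
      omega
    have hne : e ≤ n * e := Nat.le_mul_of_pos_left e hn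
    have hG' := hG (n * e) (by omega)
    have hs : (n + 1) * e + T ≤ s (n * e) := by
      refine Nat.le_of_mul_le_mul_left (le_trans (le_of_eq ?_) hG') hn
      ring
    rw [add_one_mul] at hs
    refine ⟨e, by omega, by omega, by omega, ?_⟩
    have h1 : (s (n * e) : ℝ) ≤ s (n * e + b) := by
      exact_mod_cast hmono _ _ (by omega) (by omega)
    have h2 : ((n * e + b : ℕ) : ℝ) ≤ n * e + n := by
      exact_mod_cast Nat.add_le_add_left hb.le _
    have h3 : (E : ℝ) ≤ e := by exact_mod_cast (by omega : E ≤ e)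
    rw [div_lt_iff₀ (by linarith)] at hE
    have h4 : (E : ℝ) * (ν * (n + 1) - γ * n) ≤ e * (ν * (n + 1) - γ * n) :=
      mul_le_mul_of_nonneg_right h3 (by linarith)
    calc β * s (n * e) ≤ β * s (n * e + b) := by gcongr
      _ ≤ γ * ((n * e + b : ℕ) : ℝ) := hk
      _ ≤ γ * (n * e + n) := by gcongr
      _ ≤ ν * ((n + 1) * ((e : ℝ) - a)) := by linarith
  choose tgt htgt using key
  exact ⟨tgt, htgt⟩

variable {F : Type*} [Field F] [Fintype F]

/-- A large family of digit sequences which are exactly approximable to the order `s`. -/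
theorem exists_exact_family {n K : ℕ} (hn : 1 ≤ n) {s : ℕ → ℕ}
    (hmono : ∀ k k', K ≤ k → k ≤ k' → s k ≤ s k')
    (hgrow : ∀ C : ℕ, ∀ᶠ k in atTop, (n + 1) * k + C ≤ n * s k) {β γ : ℝ} (hβ : 0 < β)
    (hγ : γ < n + 1) (hfreq : ∃ᶠ k : ℕ in atTop, β * s k ≤ γ * k) :
    ∃ Φ : (ℕ → Fin (Fintype.card F)) → Fin n → ℕ → F,
      (∀ ω m, ∃ g : F[X], g.Monic ∧ m ≤ g.natDegree ∧ g.natDegree < s g.natDegree ∧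
        Kills (Φ ω) (s g.natDegree - g.natDegree - 1) g ∧
        ∃ i, act g (Φ ω i) (s g.natDegree - g.natDegree - 1) ≠ 0) ∧
      (∃ m, ∀ ω, ∀ g : F[X], g ≠ 0 → m ≤ g.natDegree →
        ∃ i j, act g (Φ ω i) j ≠ 0 ∧ j + 1 + g.natDegree ≤ s g.natDegree) ∧
      ∃ C : ℝ, ∀ ω ω' (p : ℕ), (∀ t < p, ω t = ω' t) → ω p ≠ ω' p →
        ∃ i, ∃ t : ℕ, Φ ω i t ≠ Φ ω' i t ∧ β * (t + 1) ≤ p + C := by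
  obtain ⟨T, hT, hβν, tgt, htgt⟩ := exists_parameters hn hmono hgrow hβ hγ hfreq
  let h : ℕ → ℕ := fun e => s (n * e) - n * e
  obtain ⟨σ, hσ0, hs, hv⟩ := St.exists_path (n := n) (T := T) (K := K) (h := h) (tgt := tgt)
    fun a => ⟨(htgt a).1, (htgt a).2.1, (htgt a).2.2.1⟩
  have hD : StrictMono fun j => (σ j).places n h :=
    strictMono_nat_of_lt_succ fun j => (hs j).places_lt hT hn (hv j)
  have hDj : ∀ j, j ≤ (σ j).places n h := hD.id_le
  have hg0 : (σ 0).Good h (fun _ _ => 0 : Fin n → ℕ → F) := by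
    rw [hσ0]
    intro g hg _
    rw [mul_zero, mem_degreeLT, Nat.cast_zero] at hg
    exact degree_eq_bot.1 (Nat.WithBot.lt_zero_iff.1 hg)
  obtain ⟨Φ, hΦ, hsep⟩ := exists_branches (F := F) hD
    (Good := fun j => (σ j).Good h) hg0
    (fun j x x' hx hg => St.Good.congr hT (hv j) hx hg)
    (fun j x hg => (hs j).hasChildren hT hn (hv j) hg)
  set A : ℕ → ℕ := fun j => ∑ k ∈ Finset.range j, St.branching n (σ k) (σ (k + 1)) with hA
  have hAs : ∀ j, A (j + 1) = A j + St.branching n (σ j) (σ (j + 1)) :=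
    fun j => Finset.sum_range_succ _ _
  have hbud : ∀ j, St.Budget n s h β ((n : ℝ) - 2 / T) (σ j) (A j) := by
    intro j
    induction j with
    | zero =>
      rw [hσ0]
      have := (htgt 0).2.2.2
      simp only [St.Budget, hA, Finset.range_zero, Finset.sum_empty, Nat.cast_zero, mul_zero,
        le_refl, true_and, zero_add]
      simpa using this
    | succ j ih =>
      rw [hAs, Nat.cast_add]
      exact ih.next hT hn rfl hβ.le hβν (fun e => rfl) (fun a => (htgt a).2.2.2) (hv j) (hs j)
  refine ⟨Φ, fun ω m => ?_, ?_, ?_⟩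
  · obtain ⟨j, e, hj, hm⟩ := St.exists_locked_ge hT hσ0 hs hv (fun a => (htgt a).1) m
    have h1 := hΦ ω j
    have h2 := hv j
    rw [hj] at h1 h2
    obtain ⟨g, hgm, hgd, hk, hi, -⟩ := h1
    have h3 : h e = s (n * e) - n * e := rfl
    have h4 := h2.2.1
    have h5 : e ≤ n * e := Nat.le_mul_of_pos_left e hn
    refine ⟨g, hgm, by omega, by rw [hgd]; omega, ?_, ?_⟩
    · rw [hgd]; exact hk
    · rw [hgd]; exact hi
  · obtain ⟨m, hm⟩ := eventually_atTop.1 (hgrow (n * (2 * T)))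
    refine ⟨m, fun ω g hg hgm => ?_⟩
    have hex : ∃ J, g.natDegree < (σ J).controlled n h := by
      refine ⟨2 * (g.natDegree + 1), ?_⟩
      have h1 := hDj (2 * (g.natDegree + 1))
      have h2 := St.places_le_two_mul_controlled hn (hv (2 * (g.natDegree + 1)))
      omega
    have hJ0 : Nat.find hex ≠ 0 := by
      intro h0
      have := Nat.find_spec hex
      rw [h0, hσ0] at this
      simp [St.controlled] at this
    obtain ⟨j, hj⟩ := Nat.exists_eq_succ_of_ne_zero hJ0
    have h1 := Nat.find_spec hex
    rw [hj] at h1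
    have h2 := Nat.find_min hex (m := j) (by omega)
    exact St.Good.exists_digit hn hT (fun e => rfl) hmono (hv j) (hs j) (hΦ ω (j + 1)) hg
      (not_lt.1 h2) h1 (hm _ hgm)
  · refine ⟨β * ((n + 1) * (2 * T)), fun ω ω' p hlt hne => ?_⟩
    have hex : ∃ J, p < A J := by
      obtain ⟨J, hJ⟩ := exists_nat_gt ((p : ℝ) / β)
      refine ⟨J, ?_⟩
      rw [div_lt_iff₀ hβ] at hJ
      have h1 := (hbud J).places_le
      have h2 : (J : ℝ) ≤ (σ J).places n h := by exact_mod_cast hDj J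
      have h3 : β * J ≤ β * (σ J).places n h := mul_le_mul_of_nonneg_left h2 hβ.le
      have : (p : ℝ) < A J := by linarith
      exact_mod_cast this
    have hJ0 : Nat.find hex ≠ 0 := by
      intro h0
      have := Nat.find_spec hex
      rw [h0] at this
      simp [hA] at this
    obtain ⟨j, hj⟩ := Nat.exists_eq_succ_of_ne_zero hJ0
    have h1 := Nat.find_spec hex
    rw [hj] at h1
    have h2 := not_lt.1 (Nat.find_min hex (m := j) (by omega))
    obtain ⟨i, t, ht, hne'⟩ := hsep ω ω' j (fun t ht => hlt t (lt_of_lt_of_le ht h2)) ⟨p, h1, hne⟩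
    refine ⟨i, t, hne', ?_⟩
    -- The first difference p falls in the label block of step j, so this step branches and is not
    -- an insertion.
    have h3 : 0 < St.branching n (σ j) (σ (j + 1)) := by
      have := hAs j
      simp only [Nat.succ_eq_add_one] at h1
      omega
    have h4 := St.places_next_le (hs j) h3
    have h5 : (t : ℝ) + 1 ≤ (σ j).places n h + (n + 1) * (2 * T) := by
      exact_mod_cast (show t + 1 ≤ _ from ht).trans h4
    have h6 := (hbud j).places_le
    have h7 : (A j : ℝ) ≤ p := by exact_mod_cast h2
    have h8 := mul_le_mul_of_nonneg_left h5 hβ.le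
    rw [mul_add β ((σ j).places n h : ℝ)] at h8
    linarith

end DigitSeq

/-! ### From digit sequences to Laurent series -/

namespace SeriesAtInfty

open DigitSeq

variable {F : Type*} [Field F]

/-- The coefficient of `(X⁻¹)^i`. -/
def cf (x : SeriesAtInfty F) (i : ℤ) : F := HahnSeries.coeff (Γ := ℤ) (R := F) x i

theorem cf_ext {x y : SeriesAtInfty F} (h : ∀ i, cf x i = cf y i) : x = y :=
  HahnSeries.ext (funext h)

theorem cf_zero (i : ℤ) : cf (0 : SeriesAtInfty F) i = 0 := rfl

theorem cf_add (x y : SeriesAtInfty F) (i : ℤ) : cf (x + y) i = cf x i + cf y i :=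
  HahnSeries.coeff_add (x := (x : HahnSeries ℤ F)) (y := (y : HahnSeries ℤ F))

theorem cf_sub (x y : SeriesAtInfty F) (i : ℤ) : cf (x - y) i = cf x i - cf y i :=
  HahnSeries.coeff_sub (x := (x : HahnSeries ℤ F)) (y := (y : HahnSeries ℤ F))

theorem cf_ofPoly_X_mul (x : SeriesAtInfty F) (i : ℤ) : cf (ofPoly X * x) i = cf x (i + 1) := by
  have h : (ofPoly (X : F[X]) : SeriesAtInfty F) = (HahnSeries.single (-1 : ℤ) (1 : F) :
      HahnSeries ℤ F) := by
    simp only [ofPoly]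
    exact eval₂_X _ _
  rw [h]
  have := HahnSeries.coeff_single_mul (r := (1 : F)) (x := (x : HahnSeries ℤ F)) (a := i) (b := -1)
  rw [one_mul, sub_neg_eq_add] at this
  exact this

theorem cf_ofPoly_C_mul (c : F) (x : SeriesAtInfty F) (i : ℤ) :
    cf (ofPoly (C c) * x) i = c * cf x i := by
  have h : (ofPoly (C c : F[X]) : SeriesAtInfty F) = (HahnSeries.single (0 : ℤ) c :
      HahnSeries ℤ F) := by
    simp only [ofPoly]
    exact eval₂_C _ _
  rw [h]
  have := HahnSeries.coeff_single_mul (r := c) (x := (x : HahnSeries ℤ F)) (a := i) (b := 0)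
  rw [sub_zero] at this
  exact this

theorem cf_one (i : ℤ) : cf (1 : SeriesAtInfty F) i = if i = 0 then 1 else 0 := by
  have := HahnSeries.coeff_one (Γ := ℤ) (R := F) (a := i)
  split_ifs with h
  · exact this.trans (if_pos h)
  · exact this.trans (if_neg h)

theorem cf_ofPoly (f : F[X]) (i : ℤ) :
    cf (ofPoly f) i = if i ≤ 0 then f.coeff (-i).toNat else 0 := by
  induction f using Polynomial.induction_on generalizing i with
  | C c =>
    have := cf_ofPoly_C_mul c (1 : SeriesAtInfty F) i
    rw [mul_one, cf_one] at this
    rw [this]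
    rcases lt_trichotomy i 0 with h | h | h
    · rw [if_neg h.ne, if_pos h.le, coeff_C_of_ne_zero (by omega), mul_zero]
    · subst h; simp
    · rw [if_neg h.ne', if_neg (by omega), mul_zero]
  | add p q hp hq =>
    rw [map_add, cf_add, hp, hq]
    split_ifs <;> simp
  | monomial m a h =>
    rw [pow_succ, ← mul_assoc, mul_comm _ X, map_mul, cf_ofPoly_X_mul, h]
    rcases lt_trichotomy i 0 with h | h | h
    · rw [if_pos (by omega), if_pos h.le, show (-i).toNat = (-(i + 1)).toNat + 1 by omega,
        coeff_X_mul]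
    · subst h; simp
    · rw [if_neg (by omega), if_neg (by omega)]

/-- The series `∑ y_j X^{-(j+1)}`. -/
def ofDigits (y : ℕ → F) : SeriesAtInfty F :=
  (HahnSeries.ofSuppBddBelow (fun i : ℤ => if 0 < i then y (i - 1).toNat else 0)
    ⟨0, fun i hi => by
      by_contra h
      exact hi (if_neg (by omega))⟩ : HahnSeries ℤ F)

theorem cf_ofDigits (y : ℕ → F) (i : ℤ) :
    cf (ofDigits y) i = if 0 < i then y (i - 1).toNat else 0 := rfl

theorem ofPoly_X_mul_ofDigits (y : ℕ → F) :
    ofPoly X * ofDigits y = ofDigits (act X y) + ofPoly (C (y 0)) := by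
  refine cf_ext fun i => ?_
  rw [cf_ofPoly_X_mul, cf_add, cf_ofDigits, cf_ofDigits, cf_ofPoly]
  rcases lt_trichotomy i 0 with h | h | h
  · rw [if_neg (by omega), if_neg (by omega), if_pos h.le, coeff_C_of_ne_zero (by omega), add_zero]
  · subst h; simp
  · rw [if_pos (by omega), if_pos h, if_neg (by omega), add_zero, act_X]
    congr 1; omega

/-- Thus `act g y` is the fractional part of g times the series of y: each shift by X drops one
leading digit into the polynomial part. -/
theorem exists_ofPoly_mul_ofDigits (g : F[X]) (y : ℕ → F) :
    ∃ f : F[X], ofPoly g * ofDigits y = ofDigits (act g y) + ofPoly f := by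
  induction g using Polynomial.induction_on generalizing y with
  | C c =>
    refine ⟨0, cf_ext fun i => ?_⟩
    rw [cf_ofPoly_C_mul, map_zero, add_zero, cf_ofDigits, cf_ofDigits, act_C]
    split_ifs <;> simp
  | add p q hp hq =>
    obtain ⟨f, hf⟩ := hp y
    obtain ⟨f', hf'⟩ := hq y
    refine ⟨f + f', ?_⟩
    rw [map_add, add_mul, hf, hf', map_add, act_add]
    refine cf_ext fun i => ?_
    simp only [cf_add, cf_ofDigits, Pi.add_apply]
    split_ifs <;> ring
  | monomial m a h =>
    obtain ⟨f, hf⟩ := h (act X y)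
    refine ⟨f + C a * X ^ m * C (y 0), ?_⟩
    rw [pow_succ, ← mul_assoc, map_mul, mul_assoc, ofPoly_X_mul_ofDigits, mul_add, hf, act_mul (C a * X ^ m) X,
      map_add, map_mul (ofPoly (F := F)) (C a * X ^ m) (C (y 0)), add_assoc]

variable [Finite F]

theorem le_norm_of_cf_ne_zero {x : SeriesAtInfty F} {i : ℤ} (h : cf x i ≠ 0) :
    (Nat.card F : ℝ) ^ (-i) ≤ ‖x‖ := by
  have hx : x ≠ 0 := fun h0 => h (by rw [h0, cf_zero])
  change _ ≤ absVal x
  rw [absVal_of_ne hx]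
  refine zpow_le_zpow_right₀ one_lt_card.le (neg_le_neg ?_)
  exact HahnSeries.order_le_of_coeff_ne_zero h

theorem norm_le_of_cf_eq_zero {x : SeriesAtInfty F} {i : ℤ} (h : ∀ j < i, cf x j = 0) :
    ‖x‖ ≤ (Nat.card F : ℝ) ^ (-i) := by
  change absVal x ≤ _
  by_cases hx : x = 0
  · rw [hx, absVal_zero]
    exact zpow_nonneg (zero_le_one.trans one_lt_card.le) _
  rw [absVal_of_ne hx]
  refine zpow_le_zpow_right₀ one_lt_card.le (neg_le_neg ?_)
  by_contra hlt
  have := h _ (not_le.1 hlt)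
  exact hx ((HahnSeries.coeff_order_eq_zero (x := (x : HahnSeries ℤ F))).1 this)

theorem norm_ofPoly {g : F[X]} (hg : g ≠ 0) : ‖ofPoly g‖ = (Nat.card F : ℝ) ^ g.natDegree := by
  rw [← zpow_natCast]
  refine le_antisymm ?_ ?_
  · have := norm_le_of_cf_eq_zero (x := ofPoly g) (i := -(g.natDegree : ℤ)) fun j hj => by
      rw [cf_ofPoly, if_pos (by omega), coeff_eq_zero_of_natDegree_lt (by omega)]
    rwa [neg_neg] at this
  · have := le_norm_of_cf_ne_zero (x := ofPoly g) (i := -(g.natDegree : ℤ)) (by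
      rw [cf_ofPoly, if_pos (by omega), neg_neg, Int.toNat_natCast]
      exact leadingCoeff_ne_zero.2 hg)
    rwa [neg_neg] at this

theorem ofPoly_ne_zero {g : F[X]} (hg : g ≠ 0) : (ofPoly g : SeriesAtInfty F) ≠ 0 := by
  rw [← norm_pos_iff, norm_ofPoly hg]
  exact pow_pos (zero_lt_one.trans one_lt_card) _

theorem norm_ofDigits_le_one (y : ℕ → F) : ‖ofDigits y‖ ≤ 1 := by
  have := norm_le_of_cf_eq_zero (x := ofDigits y) (i := 0) fun j hj => by
    rw [cf_ofDigits, if_neg (by omega)]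
  simpa using this

theorem le_norm_sub_ofDigits {y y' : ℕ → F} {t : ℕ} (h : y t ≠ y' t) :
    (Nat.card F : ℝ) ^ (-((t : ℤ) + 1)) ≤ ‖ofDigits y - ofDigits y'‖ := by
  refine le_norm_of_cf_ne_zero ?_
  rw [cf_sub, cf_ofDigits, cf_ofDigits, if_pos (by omega), if_pos (by omega)]
  simpa using sub_ne_zero.2 h

theorem norm_sub_ofDigits_le {y y' : ℕ → F} {t : ℕ} (h : ∀ j < t, y j = y' j) :
    ‖ofDigits y - ofDigits y'‖ ≤ (Nat.card F : ℝ) ^ (-((t : ℤ) + 1)) := by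
  refine norm_le_of_cf_eq_zero fun j hj => ?_
  rw [cf_sub, cf_ofDigits, cf_ofDigits]
  split_ifs with h0
  · rw [h _ (by omega), sub_self]
  · rw [sub_self]

/-- A nonzero fractional digit of `g • y` bounds the distance of `y` to the fractions with
denominator `g` from below. -/
theorem le_norm_ofDigits_sub_div {y : ℕ → F} {g f : F[X]} {j : ℕ} (hg : g ≠ 0)
    (h : act g y j ≠ 0) :
    (Nat.card F : ℝ) ^ (-((j : ℤ) + 1 + g.natDegree)) ≤ ‖ofDigits y - ofPoly f / ofPoly g‖ := by
  have hq : (0 : ℝ) < Nat.card F := zero_lt_one.trans one_lt_card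
  obtain ⟨f', hf'⟩ := exists_ofPoly_mul_ofDigits g y
  have h1 : ofDigits y - ofPoly f / ofPoly g =
      (ofDigits (act g y) + ofPoly (f' - f)) / ofPoly g := by
    rw [eq_div_iff (ofPoly_ne_zero hg), sub_mul, div_mul_cancel₀ _ (ofPoly_ne_zero hg), mul_comm,
      hf', map_sub]
    ring
  rw [h1, norm_div, norm_ofPoly hg, le_div_iff₀ (pow_pos hq _), ← zpow_natCast,
    ← zpow_add₀ hq.ne', show -((j : ℤ) + 1 + g.natDegree) + g.natDegree = -((j : ℤ) + 1) by ring]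
  refine le_norm_of_cf_ne_zero ?_
  rw [cf_add, cf_ofDigits, cf_ofPoly, if_pos (by omega), if_neg (by omega), add_zero]
  simpa using h

/-- A vector of digit sequences of which `g • xᵢ` has order exactly `h` is at distance exactly
`q ^ (-(h + deg g))` from a rational vector with denominator `g`. -/
theorem exists_norm_sub_ratVec_eq {n h : ℕ} {x : Fin n → ℕ → F} {g : F[X]} (hg : g.Monic)
    (hh : 1 ≤ h) (hk : Kills x (h - 1) g) (hi : ∃ i, act g (x i) (h - 1) ≠ 0) :
    ∃ f : Fin n → F[X], ‖(fun i => ofDigits (x i)) - ratVec f g‖ =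
      (Nat.card F : ℝ) ^ (-((h : ℤ) + g.natDegree)) := by
  have hq : (0 : ℝ) < Nat.card F := zero_lt_one.trans one_lt_card
  -- The sequence annihilated by g with the initial digits of x expands a fraction with denominator
  -- g. It follows x up to place deg g + h - 1, where in some coordinate they differ.
  choose y hy hy0 using fun i => exists_act_eq hg (0 : ℕ → F) (x i)
  choose f hf using fun i => exists_ofPoly_mul_ofDigits g (y i)
  have hyf : ∀ i, ofPoly (f i) / ofPoly g = ofDigits (y i) := fun i => by
    rw [div_eq_iff (ofPoly_ne_zero hg.ne_zero), mul_comm, hf, hy,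
      show ofDigits (0 : ℕ → F) = 0 from cf_ext fun i => by rw [cf_ofDigits]; simp [cf_zero],
      zero_add]
  have hxy : ∀ i, ∀ t < g.natDegree + (h - 1), x i t = y i t := fun i =>
    eq_of_act_eq hg (fun t ht => (hy0 i t ht).symm) fun j hj => by rw [hk i j hj, hy]; rfl
  have hexp : -((h : ℤ) + g.natDegree) = -(((g.natDegree + (h - 1) : ℕ) : ℤ) + 1) := by omega
  refine ⟨f, le_antisymm ?_ ?_⟩
  · rw [pi_norm_le_iff_of_nonneg (zpow_nonneg hq.le _)]
    intro i
    rw [Pi.sub_apply, ratVec, hyf, hexp]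
    exact norm_sub_ofDigits_le (hxy i)
  · obtain ⟨i, hi⟩ := hi
    refine le_trans ?_ (norm_le_pi_norm _ i)
    rw [Pi.sub_apply, ratVec, hyf, hexp]
    refine le_norm_sub_ofDigits fun heq => hi ?_
    rw [act_congr (y' := y i), hy]
    · rfl
    · intro t ht
      rcases Nat.lt_or_ge t (g.natDegree + (h - 1)) with hlt | hge
      · exact hxy i t hlt
      · rw [show t = g.natDegree + (h - 1) by omega, heq]

end SeriesAtInfty

open DigitSeq SeriesAtInfty in
/-- Digit sequences with the approximation properties of `exists_exact_family` are exactly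
`ψ`-approximable. -/
theorem ofDigits_mem_exactApprox {F : Type*} [Field F] [Finite F] {n K : ℕ} {ψ : ℝ → ℝ}
    {s : ℕ → ℕ} (hψ : ∀ k, K ≤ k → ψ ((Nat.card F : ℝ) ^ k) = (Nat.card F : ℝ) ^ (-(s k : ℤ)))
    {x : Fin n → ℕ → F}
    (h1 : ∀ m, ∃ g : F[X], g.Monic ∧ m ≤ g.natDegree ∧ g.natDegree < s g.natDegree ∧
        Kills x (s g.natDegree - g.natDegree - 1) g ∧
        ∃ i, act g (x i) (s g.natDegree - g.natDegree - 1) ≠ 0)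
    (h2 : ∃ m, ∀ g : F[X], g ≠ 0 → m ≤ g.natDegree →
        ∃ i j, act g (x i) j ≠ 0 ∧ j + 1 + g.natDegree ≤ s g.natDegree) :
    (fun i => SeriesAtInfty.ofDigits (x i)) ∈ exactApprox F n ψ := by
  have hq : (1 : ℝ) < Nat.card F := one_lt_card
  refine ⟨fun i => norm_ofDigits_le_one _, ?_, ?_⟩
  · refine Set.Infinite.of_image (fun p => p.2.natDegree) (Set.infinite_of_not_bddAbove ?_)
    rintro ⟨B, hB⟩
    obtain ⟨g, hg, hd, hs, hk, hi⟩ := h1 (max K (B + 1))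
    obtain ⟨f, hf⟩ := exists_norm_sub_ratVec_eq hg (by omega) hk hi
    have : g.natDegree ≤ B := hB ⟨(f, g), ⟨hg.ne_zero, ?_⟩, rfl⟩
    · have := le_trans (le_max_right _ _) hd
      omega
    · dsimp only
      rw [hf, norm_ofPoly hg.ne_zero, hψ _ (le_trans (le_max_left _ _) hd)]
      congr 1
      omega
  · obtain ⟨m, hm⟩ := h2
    refine ⟨X ^ max m K, fun f g hg hle => ?_⟩
    rw [norm_ofPoly hg, norm_ofPoly (pow_ne_zero _ X_ne_zero), natDegree_X_pow,
      pow_le_pow_iff_right₀ hq] at hle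
    obtain ⟨i, j, hne, hj⟩ := hm g hg (le_trans (le_max_left _ _) hle)
    rw [norm_ofPoly hg, hψ _ (le_trans (le_max_right _ _) hle)]
    calc (Nat.card F : ℝ) ^ (-(s g.natDegree : ℤ))
        ≤ (Nat.card F : ℝ) ^ (-((j : ℤ) + 1 + g.natDegree)) :=
          zpow_le_zpow_right₀ hq.le (by omega)
      _ ≤ ‖SeriesAtInfty.ofDigits (x i) - ofPoly (f i) / ofPoly g‖ :=
          le_norm_ofDigits_sub_div hg hne
      _ ≤ _ := norm_le_pi_norm ((fun i => SeriesAtInfty.ofDigits (x i)) - ratVec f g) i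

/-! ### Hausdorff dimension and the final estimate -/

/-- A set parametrised by digit strings whose separation is controlled from below by the length of
common initial segments has large Hausdorff dimension. -/
theorem le_dimH_range_of_separated {Y : Type*} [MetricSpace Y] {q : ℕ} (hq : 1 < q)
    {Ψ : (ℕ → Fin q) → Y} {β C : ℝ} (hβ : 0 < β)
    (h : ∀ ω ω' (p : ℕ), (∀ t < p, ω t = ω' t) → ω p ≠ ω' p →
      ∃ t : ℕ, (q : ℝ) ^ (-((t : ℤ) + 1)) ≤ dist (Ψ ω) (Ψ ω') ∧ β * (t + 1) ≤ p + C) :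
    ENNReal.ofReal β ≤ dimH (Set.range Ψ) := by
  have hq0 : (0 : ℝ) < q := by positivity
  have hq1 : (1 : ℝ) ≤ q := by exact_mod_cast hq.le
  have hfirst : ∀ ω ω' : ℕ → Fin q, ω ≠ ω' → ∃ p, (∀ t < p, ω t = ω' t) ∧ ω p ≠ ω' p := by
    intro ω ω' hne
    have hex := Function.ne_iff.1 hne
    classical
    exact ⟨Nat.find hex, fun t ht => not_not.1 (Nat.find_min hex ht), Nat.find_spec hex⟩
  have hinj : Function.Injective Ψ := by
    intro ω ω' heq
    by_contra hne
    obtain ⟨p, h1, h2⟩ := hfirst ω ω' hne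
    obtain ⟨t, ht, -⟩ := h ω ω' p h1 h2
    rw [heq, dist_self] at ht
    exact absurd ht (not_le.2 (zpow_pos hq0 _))
  -- This inverts the parametrisation and reads the label string as a base-q real. It is Hölder of
  -- exponent β on the range and maps it onto [0, 1].
  let f : Y → ℝ := Function.extend Ψ Real.ofDigits 0
  have hf : ∀ ω, f (Ψ ω) = Real.ofDigits ω := fun ω => hinj.extend_apply _ _ ω
  let C' : NNReal := ⟨(q : ℝ) ^ C, by positivity⟩
  let r : NNReal := ⟨β, hβ.le⟩
  have hholder : HolderOnWith C' r f (Set.range Ψ) := by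
    rintro _ ⟨ω, rfl⟩ _ ⟨ω', rfl⟩
    rw [hf, hf]
    by_cases hne : ω = ω'
    · rw [hne, edist_self]; exact bot_le
    obtain ⟨p, h1, h2⟩ := hfirst ω ω' hne
    obtain ⟨t, ht, htp⟩ := h ω ω' p h1 h2
    have hd : dist (Real.ofDigits ω) (Real.ofDigits ω') ≤
        (q : ℝ) ^ C * dist (Ψ ω) (Ψ ω') ^ β := by
      calc dist (Real.ofDigits ω) (Real.ofDigits ω') ≤ ((q : ℝ) ^ p)⁻¹ :=
            Real.abs_ofDigits_sub_ofDigits_le h1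
        _ = (q : ℝ) ^ (-(p : ℝ)) := by rw [Real.rpow_neg hq0.le, Real.rpow_natCast]
        _ ≤ (q : ℝ) ^ (C + (-((t : ℝ) + 1)) * β) :=
            Real.rpow_le_rpow_of_exponent_le hq1 (by linarith)
        _ = (q : ℝ) ^ C * ((q : ℝ) ^ (-((t : ℤ) + 1))) ^ β := by
            rw [Real.rpow_add hq0, Real.rpow_mul hq0.le, ← Real.rpow_intCast]
            push_cast
            rfl
        _ ≤ _ := by gcongr
    have h3 : ENNReal.ofReal ((q : ℝ) ^ C) = (C' : ENNReal) :=
      ENNReal.ofReal_eq_coe_nnreal (by positivity)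
    rw [edist_dist, edist_dist, show (r : ℝ) = β from rfl, ENNReal.ofReal_rpow_of_nonneg dist_nonneg hβ.le, ← h3,
      ← ENNReal.ofReal_mul (by positivity)]
    exact ENNReal.ofReal_le_ofReal hd
  have himage : Set.Icc (0 : ℝ) 1 ⊆ f '' Set.range Ψ := by
    intro y hy
    obtain ⟨ω, -, hω⟩ := Real.ofDigits_SurjOn hq hy
    exact ⟨Ψ ω, ⟨ω, rfl⟩, by rw [hf, hω]⟩
  have h1 : (1 : ENNReal) ≤ dimH (Set.range Ψ) / r := by
    refine le_trans ?_ ((dimH_mono himage).trans (hholder.dimH_image_le hβ))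
    rw [Real.dimH_of_nonempty_interior (by rw [interior_Icc]; exact ⟨1 / 2, by norm_num⟩),
      Module.finrank_self, Nat.cast_one]
  have hr0 : (r : ENNReal) ≠ 0 := ENNReal.coe_ne_zero.2 (ne_of_gt (by exact hβ))
  rw [ENNReal.le_div_iff_mul_le (Or.inl hr0) (Or.inl ENNReal.coe_ne_top), one_mul] at h1
  rwa [ENNReal.ofReal_eq_coe_nnreal hβ.le]

/-- The exponents of the values of `ψ` at large powers of `q`. -/
theorem exists_exponents {q n : ℕ} (hq : 1 < q) (hn : 1 ≤ n) {ψ : ℝ → ℝ}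
    (hanti : AntitoneOn ψ (Set.Ioi 0))
    (hval : ∀ᶠ k : ℕ in atTop, ∃ j : ℤ, ψ ((q : ℝ) ^ k) = (q : ℝ) ^ j)
    (hlittle : (fun k : ℕ => ψ ((q : ℝ) ^ k)) =o[atTop]
      (fun k : ℕ => ((q : ℝ) ^ k) ^ (-(((n : ℝ) + 1) / (n : ℝ))))) :
    ∃ (s : ℕ → ℕ) (K : ℕ), (∀ k, K ≤ k → ψ ((q : ℝ) ^ k) = (q : ℝ) ^ (-(s k : ℤ))) ∧
      (∀ k k', K ≤ k → k ≤ k' → s k ≤ s k') ∧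
      ∀ C : ℕ, ∀ᶠ k in atTop, (n + 1) * k + C ≤ n * s k := by
  have hq0 : (0 : ℝ) < q := by positivity
  have hq1 : (1 : ℝ) < q := by exact_mod_cast hq
  have hn0 : (0 : ℝ) < n := by exact_mod_cast hn
  have hlt : ∀ C : ℕ, ∀ᶠ k : ℕ in atTop, ∀ j : ℤ, ψ ((q : ℝ) ^ k) = (q : ℝ) ^ j →
      (j : ℝ) ≤ -C - k * (((n : ℝ) + 1) / n) := by
    intro C
    -- The little-o constant q^(-C) becomes C extra digits in the exponent.
    filter_upwards [hlittle.def (c := (q : ℝ) ^ (-(C : ℝ))) (by positivity)] with k hk j hj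
    rw [hj, Real.norm_of_nonneg (by positivity), Real.norm_of_nonneg (by positivity),
      ← Real.rpow_natCast, ← Real.rpow_mul hq0.le, ← Real.rpow_add hq0, ← Real.rpow_intCast,
      Real.rpow_le_rpow_left_iff hq1] at hk
    linarith
  obtain ⟨K, hK⟩ := eventually_atTop.1 (hval.and (hlt 0))
  have hs : ∀ k, ∃ s : ℕ, K ≤ k → ψ ((q : ℝ) ^ k) = (q : ℝ) ^ (-(s : ℤ)) := by
    intro k
    by_cases hk : K ≤ k
    · obtain ⟨⟨j, hj⟩, h2⟩ := hK k hk
      have h3 := h2 j hj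
      have h4 : (0 : ℝ) ≤ k * (((n : ℝ) + 1) / n) := by positivity
      have h5 : j ≤ 0 := by
        rw [Nat.cast_zero] at h3
        exact_mod_cast (by linarith : (j : ℝ) ≤ 0)
      exact ⟨(-j).toNat, fun _ => by rw [hj, Int.toNat_of_nonneg (by omega), neg_neg]⟩
    · exact ⟨0, fun h => absurd h hk⟩
  choose s hs using hs
  refine ⟨s, K, hs, fun k k' hk hkk => ?_, fun C => ?_⟩
  · have h1 := hanti (Set.mem_Ioi.2 (pow_pos hq0 k)) (Set.mem_Ioi.2 (pow_pos hq0 k'))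
      (pow_le_pow_right₀ hq1.le hkk)
    rw [hs k hk, hs k' (hk.trans hkk), zpow_le_zpow_iff_right₀ hq1] at h1
    omega
  · filter_upwards [hlt C, eventually_ge_atTop K] with k hk hkK
    have h1 := hk _ (hs k hkK)
    push_cast at h1
    have h2 : ((n : ℝ) + 1) * k + C ≤ n * s k := by
      have h3 : (C : ℝ) + k * (((n : ℝ) + 1) / n) ≤ s k := by linarith
      have h4 := mul_le_mul_of_nonneg_left h3 hn0.le
      have h5 : n * ((C : ℝ) + k * (((n : ℝ) + 1) / n)) = n * C + (n + 1) * k := by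
        field_simp
      have h6 : (1 : ℝ) * C ≤ n * C := by gcongr; exact_mod_cast hn
      linarith
    exact_mod_cast h2

theorem theorem1p1 (F : Type*) [Field F] [Finite F] (n : ℕ) (hn : 1 ≤ n) (ψ : ℝ → ℝ)
    (hpos : ∀ r : ℝ, 0 < r → 0 < ψ r)
    (hanti : AntitoneOn ψ (Set.Ioi 0))
    (hval : ∀ᶠ k : ℕ in atTop, ∃ j : ℤ, ψ ((Nat.card F : ℝ) ^ k) = (Nat.card F : ℝ) ^ j)
    (hlittle : (fun k : ℕ => ψ ((Nat.card F : ℝ) ^ k)) =o[atTop]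
      (fun k : ℕ => ((Nat.card F : ℝ) ^ k) ^ (-(((n : ℝ) + 1) / (n : ℝ))))) :
    ((n : EReal) + 1) / lowerOrder (Nat.card F) ψ ≤ ((dimH (exactApprox F n ψ) : ENNReal) : EReal) := by
  have hq : 1 < Nat.card F := Finite.one_lt_card
  have hq1 : (1 : ℝ) < Nat.card F := by exact_mod_cast hq
  have hlog : 0 < Real.log (Nat.card F) := Real.log_pos hq1
  obtain ⟨s, K, hψ, hmono, hgrow⟩ := exists_exponents hq hn hanti hval hlittle
  have hratio : ∀ᶠ k : ℕ in atTop, -Real.log (ψ ((Nat.card F : ℝ) ^ k)) /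
      Real.log ((Nat.card F : ℝ) ^ k) = (s k : ℝ) / k := by
    filter_upwards [eventually_ge_atTop K] with k hk
    rw [hψ k hk, Real.log_zpow, Real.log_pow]
    push_cast
    rw [neg_mul, neg_neg, mul_div_mul_right _ _ hlog.ne']
  set lam := lowerOrder (Nat.card F) ψ with hlam
  have hlam1 : 1 ≤ lam := by
    refine le_liminf_of_le (by isBoundedDefault) ?_
    filter_upwards [hratio, hgrow 0, eventually_gt_atTop 0] with k hk hgk hk0
    rw [hk]
    have h1 : k ≤ s k := Nat.le_of_mul_le_mul_left
      (le_trans (Nat.mul_le_mul_right k (Nat.le_succ n)) hgk) hn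
    have h2 : (1 : ℝ) ≤ (s k : ℝ) / k := by
      rw [one_le_div (by exact_mod_cast hk0)]
      exact_mod_cast h1
    exact_mod_cast h2
  by_cases htop : lam = ⊤
  · rw [htop, EReal.div_top]
    exact EReal.coe_ennreal_nonneg _
  have hlam0 : 0 < lam := lt_of_lt_of_le zero_lt_one hlam1
  by_contra hcon
  obtain ⟨β, hβd, hβ⟩ := EReal.lt_iff_exists_real_btwn.1 (not_le.1 hcon)
  have hβ0 : 0 < β := by
    have := (EReal.coe_ennreal_nonneg _).trans_lt hβd
    exact_mod_cast this
  rw [EReal.lt_div_iff hlam0 htop] at hβ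
  lift lam to ℝ using ⟨htop, ne_of_gt (lt_trans (EReal.bot_lt_zero) hlam0)⟩ with l hl
  have hβl : β * l < n + 1 := by exact_mod_cast hβ
  -- With γ = β * l' there is room on both sides: s k / k < l' holds infinitely often, and γ < n +
  -- 1.
  obtain ⟨l', hl1, hl2⟩ := exists_between (show l < (n + 1) / β by
    rw [lt_div_iff₀ hβ0]; linarith)
  have hfreq : ∃ᶠ k : ℕ in atTop, β * s k ≤ (β * l') * k := by
    have h1 : ∃ᶠ k : ℕ in atTop, ((-Real.log (ψ ((Nat.card F : ℝ) ^ k)) /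
        Real.log ((Nat.card F : ℝ) ^ k) : ℝ) : EReal) < (l' : EReal) := by
      refine frequently_lt_of_liminf_lt (by isBoundedDefault) ?_
      change lowerOrder (Nat.card F) ψ < _
      rw [← hlam]
      exact_mod_cast hl1
    refine (h1.and_eventually (hratio.and (eventually_gt_atTop 0))).mono fun k hk => ?_
    obtain ⟨h2, h3, h4⟩ := hk
    rw [h3] at h2
    have h5 : (s k : ℝ) / k < l' := by exact_mod_cast h2
    rw [div_lt_iff₀ (by exact_mod_cast h4)] at h5
    rw [mul_assoc]
    gcongr
  have hγ : β * l' < n + 1 := by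
    rw [lt_div_iff₀ hβ0] at hl2; linarith
  have : Fintype F := Fintype.ofFinite F
  obtain ⟨Φ, h1, h2, C, h3⟩ := DigitSeq.exists_exact_family (F := F) hn hmono hgrow hβ0 hγ hfreq
  let Ψ : (ℕ → Fin (Fintype.card F)) → Fin n → SeriesAtInfty F :=
    fun ω i => SeriesAtInfty.ofDigits (Φ ω i)
  have hsub : Set.range Ψ ⊆ exactApprox F n ψ := by
    rintro _ ⟨ω, rfl⟩
    exact ofDigits_mem_exactApprox hψ (h1 ω) (h2.imp fun m hm => hm ω)
  have hdim := le_dimH_range_of_separated (Ψ := Ψ) Fintype.one_lt_card hβ0 (C := C)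
    fun ω ω' p hlt hne => by
      obtain ⟨i, t, hit, ht⟩ := h3 ω ω' p hlt hne
      refine ⟨t, ?_, ht⟩
      refine le_trans ?_ (dist_le_pi_dist (Ψ ω) (Ψ ω') i)
      rw [dist_eq_norm, ← Nat.card_eq_fintype_card]
      exact SeriesAtInfty.le_norm_sub_ofDigits hit
  have h4 : (β : EReal) ≤ ((dimH (exactApprox F n ψ) : ENNReal) : EReal) := by
    have h5 := hdim.trans (dimH_mono hsub)
    have h6 : ((ENNReal.ofReal β : ENNReal) : EReal) = (β : EReal) := by
      rw [EReal.coe_ennreal_ofReal, max_eq_left hβ0.le]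
    rw [← h6]
    exact_mod_cast h5
  exact absurd hβd (not_lt.2 h4)
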